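/- Let $d\ge 0$, let $I,J$ be finite non-empty index sets and let $\ell$ range over a finite set. Write $\mathcal S^d$ for the real symmetric $d\times d$ matrices, $\mathcal S^d_+$ (resp. $\mathcal S^d_{++}$) for the positive semidefinite (resp. positive definite) ones. Let $c_{ij}\in\mathcal S^d$ for $(i,j)\in I\times J$, let $\rho,\epsilon>0$, let $w_\ell>0$ with $\sum_\ell w_\ell=1$, and let $\mu^\ell=(\mu^\ell_i)_{i\in I}$ be collections of matrices in $\mathcal S^d_+$. For $P\in\mathcal S^d_+$ put $H(P)=-\mathrm{tr}(P\log P-P)$ (with $0\log 0=0$), and for $P,Q\in\mathcal S^d_+$ put $\mathrm{KL}(P|Q)=\mathrm{tr}(P\log P-P\log Q-P+Q)$ if $\ker Q\subset\ker P$ (where $P\log Q$ is computed with $\log Q$ set to $0$ on $\ker Q$) and $\mathrm{KL}(P|Q)=+\infty$ otherwise. For $P\in\mathcal S^d$ and $Q\in\mathcal S^d_+$, $e^{P+\log Q}$ denotes the positive semidefinite matrix that vanishes on $\ker Q$ and that is, on $(\ker Q)^\perp$, the exponential of the sum of the compression of $P$ and of $\log Q$. For $\nu=(\nu_j)_{j\in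 J}\in(\mathcal S^d_+)^J$ let (this is the case $\rho_1=\rho$, $\rho_2=+\infty$, i.e. a hard constraint on the second marginal) $$W_\epsilon(\mu^\ell,\nu)=\inf\Big\{\sum_{i,j}\mathrm{tr}(\gamma_{ij}c_{ij})+\rho\sum_i\mathrm{KL}\Big(\sum_j\gamma_{ij}\Big|\mu^\ell_i\Big)-\epsilon\sum_{i,j}H(\gamma_{ij})\ :\ \gamma_{ij}\in\mathcal S^d_+,\ \sum_i\gamma_{ij}=\nu_j\Big\}\in(-\infty,+\infty].$$ Consider the barycenter problem $$\min_{\nu\in(\mathcal S^d_+)^J}\ \sum_\ell w_\ell W_\epsilon(\mu^\ell,\nu).\qquad(1)$$ For collections $u^\ell=(u_i^\ell)_{i\in I}$, $v^\ell=(v_j^\ell)_{j\in J}$ of arbitrary matrices in $\mathcal S^d$ let $$L(\nu;(u^\ell,v^\ell)_\ell)=-\sum_\ell w_\ell\,\mathrm{tr}\Big[\rho\sum_i e^{u_i^\ell+\log\mu_i^\ell}+\sum_j\nu_jv_j^\ell+\epsilon\sum_{i,j}e^{K(u^\ell,v^\ell)_{ij}}\Big],\qquad K(u,v)_{ij}=-\frac{c_{ij}+\rho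 u_i+v_j}{\epsilon}.$$ In what follows $\nu$ ranges over $(\mathcal S^d_+)^J$ and $(u^\ell,v^\ell)_\ell$ over all collections of symmetric matrices; infima and suprema are taken in $[-\infty,+\infty]$. Let $C=\rho\sum_\ell w_\ell\sum_i\mathrm{tr}(\mu_i^\ell)$. (a) Problem (1) has exactly one solution. (b) For every $\nu$, $\sum_\ell w_\ell W_\epsilon(\mu^\ell,\nu)=C+\sup_{(u^\ell,v^\ell)}L(\nu;(u^\ell,v^\ell)_\ell)$. (c) The optimal value of (1) is $C+\sup_{(u^\ell,v^\ell)}\inf_{\nu}L(\nu;(u^\ell,v^\ell)_\ell)$. (d) A collection $\nu$ solves (1) if and only if $\sup_{(u^\ell,v^\ell)}L(\nu;(u^\ell,v^\ell)_\ell)=\sup_{(u^\ell,v^\ell)}\inf_{\nu'}L(\nu';(u^\ell,v^\ell)_\ell)$. (e) If all $\mu_i^\ell\in\mathcal S^d_{++}$, then the outer supremum in $\sup_{(u^\ell,v^\ell)}\inf_{\nu}L$ is a maximum; and for every maximizer $(\bar u^\ell,\bar v^\ell)_\ell$, a collection $\nu$ solves (1) if and only if $(\nu,(\bar u^\ell,\bar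 v^\ell)_\ell)$ is a saddle point of $L$: $\nu$ minimizes $L(\cdot\,;(\bar u^\ell,\bar v^\ell)_\ell)$ and $(\bar u^\ell,\bar v^\ell)_\ell$ maximizes $L(\nu;\cdot)$. -/

import Mathlib

open scoped Matrix

noncomputable section

namespace QuantumOT

/-- Real `d × d` matrices. -/
abbrev Mat (d : ℕ) := Matrix (Fin d) (Fin d) ℝ

variable {d : ℕ} {I J Λ : Type*} [Fintype I] [Fintype J] [Fintype Λ]

/-- Matrix exponential `U diag(e^{σ_s}) Uᵀ` of a symmetric matrix `U diag(σ_s) Uᵀ`. -/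
def mexp (P : Mat d) : Mat d := cfc Real.exp P

/-- Matrix logarithm `U diag(log σ_s) Uᵀ` of a positive semidefinite matrix `U diag(σ_s) Uᵀ`,
acting as `0` on the kernel. -/
def mlog (P : Mat d) : Mat d := cfc Real.log P

/-- Orthogonal projector on the range (the orthogonal of the kernel) of a symmetric matrix. -/
def rangeProj (Q : Mat d) : Mat d := cfc (fun x : ℝ => if x = 0 then 0 else 1) Q

/-- `exp (P + log Q)` for `P` symmetric and `Q` positive semidefinite: it vanishes on `ker Q`, and
on the orthogonal of `ker Q` it is the exponential of (the compression of `P`) `+ log Q`. -/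
def expAddLog (P Q : Mat d) : Mat d :=
  rangeProj Q * mexp (rangeProj Q * P * rangeProj Q + mlog Q) * rangeProj Q

/-- Quantum entropy `H(P) = -tr (P log P - P)` of a positive semidefinite matrix. -/
def entropy (P : Mat d) : ℝ := -(P * mlog P - P).trace

open Classical in
/-- Quantum Kullback-Leibler divergence `KL(P|Q)`, for `Q` positive semidefinite. It is `+∞`
unless `P` is positive semidefinite and `ker Q ⊆ ker P`. -/
def KL (P Q : Mat d) : EReal :=
  if P.PosSemidef ∧ ∀ x : Fin d → ℝ, Q *ᵥ x = 0 → P *ᵥ x = 0 then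
    (((P * mlog P - P * mlog Q - P + Q).trace : ℝ) : EReal)
  else ⊤

/-- Collections of positive semidefinite matrices (tensor-valued discrete measures on `J`). -/
def psdFields (d : ℕ) (J : Type*) : Set (J → Mat d) := {ν | ∀ j, (ν j).PosSemidef}

/-- Couplings: collections `γ_{ij}` of positive semidefinite matrices with `∑_i γ_{ij} = ν_j`. -/
def couplings (I : Type*) [Fintype I] (ν : J → Mat d) : Set (I → J → Mat d) :=
  {γ | (∀ i j, (γ i j).PosSemidef) ∧ ∀ j, ∑ i, γ i j = ν j}

/-- The regularized transport energy `⟨γ,c⟩ + ρ KL(γ 1|μ) - ε H(γ)` of a coupling. -/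
def energy (c : I → J → Mat d) (ρ ε : ℝ) (μ : I → Mat d) (γ : I → J → Mat d) : EReal :=
  (((∑ i, ∑ j, (γ i j * (c i j)ᵀ).trace : ℝ)) : EReal)
    + (ρ : EReal) * (∑ i, KL (∑ j, γ i j) (μ i))
    + ((-(ε * ∑ i, ∑ j, entropy (γ i j)) : ℝ) : EReal)

/-- `W_ε(μ,ν)` with `ρ₁ = ρ` and `ρ₂ = +∞`, i.e. with the hard constraint `∑_i γ_{ij} = ν_j`. -/
def W (c : I → J → Mat d) (ρ ε : ℝ) (μ : I → Mat d) (ν : J → Mat d) : EReal :=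
  ⨅ γ ∈ couplings I ν, energy c ρ ε μ γ

/-- The barycenter functional `∑_ℓ w_ℓ W_ε(μ^ℓ,ν)`. -/
def baryObjective (c : I → J → Mat d) (ρ ε : ℝ) (w : Λ → ℝ) (μ : Λ → I → Mat d)
    (ν : J → Mat d) : EReal :=
  ∑ l, (w l : EReal) * W c ρ ε (μ l) ν

/-- `ν` solves the barycenter problem: it minimizes the barycenter functional. -/
def IsBarycenter (c : I → J → Mat d) (ρ ε : ℝ) (w : Λ → ℝ) (μ : Λ → I → Mat d)
    (ν : J → Mat d) : Prop :=
  ν ∈ psdFields d J ∧ IsMinOn (baryObjective c ρ ε w μ) (psdFields d J) ν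

/-- `K(u,v)_{ij} = -(c_{ij} + ρ u_i + v_j)/ε`. -/
def kern (c : I → J → Mat d) (ρ ε : ℝ) (u : I → Mat d) (v : J → Mat d) (i : I) (j : J) : Mat d :=
  -(ε⁻¹ • (c i j + ρ • u i + v j))

/-- Dual variables `(u^ℓ, v^ℓ)_ℓ`: collections of arbitrary symmetric matrices. -/
def dualVars (d : ℕ) (I J Λ : Type*) : Set ((Λ → I → Mat d) × (Λ → J → Mat d)) :=
  {p | (∀ l i, (p.1 l i).IsSymm) ∧ ∀ l j, (p.2 l j).IsSymm}

/-- The function of `ν` and `(u^ℓ, v^ℓ)_ℓ` in the max-min problem: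
`-∑_ℓ w_ℓ tr[ρ ∑_i e^{u_i^ℓ + log μ_i^ℓ} + ∑_j ν_j v_j^ℓ + ε ∑_{ij} e^{K(u^ℓ,v^ℓ)_{ij}}]`. -/
def lagr (c : I → J → Mat d) (ρ ε : ℝ) (w : Λ → ℝ) (μ : Λ → I → Mat d)
    (ν : J → Mat d) (p : (Λ → I → Mat d) × (Λ → J → Mat d)) : ℝ :=
  -∑ l, w l * (ρ • ∑ i, expAddLog (p.1 l i) (μ l i) + ∑ j, ν j * p.2 l j
    + ε • ∑ i, ∑ j, mexp (kern c ρ ε (p.1 l) (p.2 l) i j)).trace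

/-- The inner minimum over `ν` (an infimum, possibly `-∞`), as a function of `(u^ℓ, v^ℓ)_ℓ`. -/
def innerMin (c : I → J → Mat d) (ρ ε : ℝ) (w : Λ → ℝ) (μ : Λ → I → Mat d)
    (p : (Λ → I → Mat d) × (Λ → J → Mat d)) : EReal :=
  ⨅ ν ∈ psdFields d J, (lagr c ρ ε w μ ν p : EReal)

end QuantumOT

end

open scoped Matrix

noncomputable section

namespace QuantumOT

section

variable {d : ℕ}

/-! ### Functional calculus of symmetric matrices -/

/-! Everything rests on the Gibbs variational principle for matrices. Klein's inequality (`klein`),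
applied to the relative entropy of P with respect to e^{u+log Q}, gives tr(Pu) - tr e^{u+log Q} + tr
Q ≤ KL(P|Q), with equality at P = e^{u+log Q}. By `exists_lt_of_lt_KL` the supremum of the left side
over u is KL(P|Q), including the value +∞. So the entropies are suprema of affine functions of P,
and u ↦ tr e^{u+log Q} is a supremum of affine functions of u: both are convex and lower
semicontinuous. The transport energy becomes a Lagrangian that is convex in the coupling γ and
concave in the potentials (u,v), and its minimum over positive semidefinite γ is attained at γ =
e^{K(u,v)}.

Duality for one transport problem (`exists_lt_dualVal_of_lt_W`) is Sion's theorem on a compact set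
of plans. If e^{K(u,v)} falls outside this set, adding multiples of the identity to v brings it back
without decreasing the Lagrangian. The weighted sum separates in ℓ, which gives (b). A second
minimax, in ν on a trace ball of radius R, gives (c): subtracting a multiple s of the identity from
every v^ℓ turns the bound on the ball into a bound on the whole cone, and the cost vanishes as R
grows, because s = O(1/R). Cancelling the constant gives (d).

For (a), the potentials u = 0, v = -1 make the dual expression of the functional coercive in tr ν,
hence a minimizer exists. Uniqueness comes from the strict convexity of the entropy, that is, from
the equality case of Klein's inequality, since W is attained by a coupling. For (e), superlevel sets
of the dual objective are bounded (`exists_bound_dualSuperlevel`), so a maximizer exists; the saddle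
point statement is then formal. -/

theorem exists_diagonalization {A : Mat d} (hA : A.IsSymm) :
    ∃ (U : Mat d) (a : Fin d → ℝ), U * Uᵀ = 1 ∧ Uᵀ * U = 1 ∧
      A = U * Matrix.diagonal a * Uᵀ ∧
      ∀ f : ℝ → ℝ, cfc f A = U * Matrix.diagonal (fun i => f (a i)) * Uᵀ := by
  have hA' : A.IsHermitian := by
    rw [Matrix.IsHermitian, Matrix.conjTranspose_eq_transpose_of_trivial]; exact hA
  have key : ∀ f : ℝ → ℝ, cfc f A = (hA'.eigenvectorUnitary : Mat d) *
      Matrix.diagonal (fun i => f (hA'.eigenvalues i)) * (hA'.eigenvectorUnitary : Mat d)ᵀ := by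
    intro f
    rw [hA'.cfc_eq, Matrix.IsHermitian.cfc, Unitary.conjStarAlgAut_apply,
      Matrix.star_eq_conjTranspose, Matrix.conjTranspose_eq_transpose_of_trivial]
    rfl
  refine ⟨hA'.eigenvectorUnitary, hA'.eigenvalues, ?_, ?_, ?_, key⟩
  · have := Unitary.coe_mul_star_self hA'.eigenvectorUnitary
    rwa [Unitary.coe_star, Matrix.star_eq_conjTranspose,
      Matrix.conjTranspose_eq_transpose_of_trivial] at this
  · have := Unitary.coe_star_mul_self hA'.eigenvectorUnitary
    rwa [Matrix.star_eq_conjTranspose,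
      Matrix.conjTranspose_eq_transpose_of_trivial] at this
  · rw [← key fun x => x, cfc_id' ℝ A hA'.isSelfAdjoint]

theorem isSymm_cfc (f : ℝ → ℝ) (A : Mat d) : (cfc f A).IsSymm := by
  have h : IsSelfAdjoint (cfc f A) := cfc_predicate f A
  rwa [IsSelfAdjoint, Matrix.star_eq_conjTranspose,
    Matrix.conjTranspose_eq_transpose_of_trivial] at h

/-- The spectrum is finite, so no continuity of f is needed; this matters for log at 0 and for the
range projector. Together with `ext_of_eigen`, it reduces identities between matrix functions to
scalar checks on eigenvectors. -/
theorem cfc_mulVec_of_eigen {A : Mat d} (hA : A.IsSymm) (f : ℝ → ℝ) {x : Fin d → ℝ} {t : ℝ}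
    (hx : A *ᵥ x = t • x) : cfc f A *ᵥ x = f t • x := by
  obtain ⟨U, a, h1, h2, h3, h4⟩ := exists_diagonalization hA
  have hy : ∀ i, a i * (Uᵀ *ᵥ x) i = t * (Uᵀ *ᵥ x) i := by
    intro i
    have := congrArg (fun z => (Uᵀ *ᵥ z) i) hx
    simp only [h3, Matrix.mulVec_mulVec, Matrix.mulVec_smul] at this
    rw [← Matrix.mul_assoc, ← Matrix.mul_assoc, h2, Matrix.one_mul, ← Matrix.mulVec_mulVec,
      Matrix.mulVec_diagonal] at this
    simpa using this
  have hf : Matrix.diagonal (fun i => f (a i)) *ᵥ (Uᵀ *ᵥ x) = f t • (Uᵀ *ᵥ x) := by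
    ext i
    rw [Matrix.mulVec_diagonal, Pi.smul_apply, smul_eq_mul]
    by_cases h0 : (Uᵀ *ᵥ x) i = 0
    · rw [h0]; simp
    · rw [mul_right_cancel₀ h0 (hy i)]
  rw [h4, ← Matrix.mulVec_mulVec, ← Matrix.mulVec_mulVec, hf, Matrix.mulVec_smul,
    Matrix.mulVec_mulVec, h1, Matrix.one_mulVec]

theorem ext_of_eigen {A M N : Mat d} (hA : A.IsSymm)
    (h : ∀ (x : Fin d → ℝ) (t : ℝ), A *ᵥ x = t • x → M *ᵥ x = N *ᵥ x) : M = N := by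
  obtain ⟨U, a, h1, h2, h3, -⟩ := exists_diagonalization hA
  have key : M * U = N * U := by
    ext i j
    have := h (fun k => U k j) (a j) (by
      have e : A * U = U * Matrix.diagonal a := by
        rw [h3, Matrix.mul_assoc, h2, Matrix.mul_one]
      ext k
      have := congrFun (congrFun e k) j
      rw [Matrix.mul_diagonal] at this
      rw [Pi.smul_apply, smul_eq_mul, mul_comm, ← this]
      rfl)
    exact congrFun this i
  calc M = M * U * Uᵀ := by rw [Matrix.mul_assoc, h1, Matrix.mul_one]
    _ = N := by rw [key, Matrix.mul_assoc, h1, Matrix.mul_one]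

theorem psd_isSymm {P : Mat d} (h : P.PosSemidef) : P.IsSymm := by
  have := h.isHermitian
  rwa [Matrix.IsHermitian, Matrix.conjTranspose_eq_transpose_of_trivial] at this

theorem psd_iff {P : Mat d} : P.PosSemidef ↔ P.IsSymm ∧ ∀ x : Fin d → ℝ, 0 ≤ x ⬝ᵥ (P *ᵥ x) := by
  rw [Matrix.posSemidef_iff_dotProduct_mulVec, Matrix.IsHermitian,
    Matrix.conjTranspose_eq_transpose_of_trivial]
  simp [Matrix.IsSymm]

theorem psd_cfc {f : ℝ → ℝ} (hf : ∀ x, 0 ≤ f x) {A : Mat d} (hA : A.IsSymm) :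
    (cfc f A).PosSemidef := by
  obtain ⟨U, a, -, -, -, h4⟩ := exists_diagonalization hA
  rw [h4, ← Matrix.conjTranspose_eq_transpose_of_trivial]
  exact (Matrix.PosSemidef.diagonal (fun i => hf _)).mul_mul_conjTranspose_same U

theorem isSymm_conj {P X : Mat d} (hP : P.IsSymm) (hX : X.IsSymm) : (P * X * P).IsSymm := by
  rw [Matrix.IsSymm, Matrix.transpose_mul, Matrix.transpose_mul, hP.eq, hX.eq, Matrix.mul_assoc]

theorem psd_mulVec_eq_zero {P : Mat d} (hP : P.PosSemidef) {x : Fin d → ℝ}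
    (hx : x ⬝ᵥ (P *ᵥ x) = 0) : P *ᵥ x = 0 := by
  have := (hP.dotProduct_mulVec_zero_iff x).1 (by simpa using hx)
  exact this

/-- Trace of a product of functions of two symmetric matrices, in terms of the squared overlaps
`O i k ^ 2` of their eigenvectors. -/
theorem exists_overlap {A B : Mat d} (hA : A.IsSymm) (hB : B.IsSymm) :
    ∃ (a b : Fin d → ℝ) (U V O : Mat d), U * Uᵀ = 1 ∧ Uᵀ * U = 1 ∧ V * Vᵀ = 1 ∧ Vᵀ * V = 1 ∧
      A = U * Matrix.diagonal a * Uᵀ ∧ B = V * Matrix.diagonal b * Vᵀ ∧ O = Uᵀ * V ∧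
      ∀ f g : ℝ → ℝ, (cfc f A * cfc g B).trace = ∑ i, ∑ k, f (a i) * g (b k) * O i k ^ 2 := by
  obtain ⟨U, a, h1, h2, h3, h4⟩ := exists_diagonalization hA
  obtain ⟨V, b, k1, k2, k3, k4⟩ := exists_diagonalization hB
  refine ⟨a, b, U, V, Uᵀ * V, h1, h2, k1, k2, h3, k3, rfl, fun f g => ?_⟩
  have e : (cfc f A * cfc g B).trace = (Matrix.diagonal (fun i => f (a i)) * (Uᵀ * V) *
      (Matrix.diagonal (fun i => g (b i)) * (Uᵀ * V)ᵀ)).trace := by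
    rw [h4, k4, Matrix.transpose_mul, Matrix.transpose_transpose, Matrix.mul_assoc,
      Matrix.mul_assoc, Matrix.trace_mul_comm]
    simp only [Matrix.mul_assoc]
  rw [e, Matrix.trace]
  refine Finset.sum_congr rfl fun i _ => ?_
  rw [Matrix.diag_apply, Matrix.mul_apply]
  refine Finset.sum_congr rfl fun k _ => ?_
  rw [Matrix.diagonal_mul, Matrix.diagonal_mul, Matrix.transpose_apply]
  ring

theorem cfc_one_eq {A : Mat d} (hA : A.IsSymm) : cfc (fun _ : ℝ => (1 : ℝ)) A = 1 :=
  ext_of_eigen hA fun x t hx => by rw [cfc_mulVec_of_eigen hA _ hx]; simp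

theorem cfc_id_eq {A : Mat d} (hA : A.IsSymm) : cfc (fun x : ℝ => x) A = A :=
  ext_of_eigen hA fun x t hx => by rw [cfc_mulVec_of_eigen hA _ hx, hx]

theorem mul_mlog_eq {A : Mat d} (hA : A.IsSymm) :
    A * mlog A = cfc (fun x : ℝ => x * Real.log x) A :=
  ext_of_eigen hA fun x t hx => by
    rw [cfc_mulVec_of_eigen hA _ hx, mlog, ← Matrix.mulVec_mulVec, cfc_mulVec_of_eigen hA _ hx,
      Matrix.mulVec_smul, hx, smul_smul, mul_comm]

/-! ### Klein's inequality -/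

theorem klein_scalar {a r : ℝ} (ha : 0 ≤ a) (hr : 0 < r) :
    0 ≤ a * Real.log a - a * Real.log r - a + r ∧
      (a * Real.log a - a * Real.log r - a + r = 0 → a = r) := by
  rcases ha.eq_or_lt with rfl | ha
  · simp only [zero_mul, sub_self, zero_add]
    exact ⟨hr.le, fun h => h.symm⟩
  · have hl : Real.log a - Real.log r = -Real.log (r / a) := by
      rw [Real.log_div hr.ne' ha.ne']; ring
    have e : a * Real.log a - a * Real.log r - a + r = a * (r / a - 1 - Real.log (r / a)) := by
      have : a * (r / a) = r := by field_simp
      linear_combination a * hl - this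
    have hpos : 0 < r / a := div_pos hr ha
    rw [e]
    constructor
    · exact mul_nonneg ha.le (by linarith [Real.log_le_sub_one_of_pos hpos])
    · intro h
      by_contra hne
      have h1 : r / a ≠ 1 := fun h' => hne ((div_eq_one_iff_eq ha.ne').1 h').symm
      have := Real.log_lt_sub_one_of_pos hpos h1
      rcases mul_eq_zero.1 h with h | h
      · exact ha.ne' h
      · linarith

theorem klein {A R : Mat d} (hA : A.PosSemidef) (hR : R.PosSemidef)
    (hker : ∀ x : Fin d → ℝ, R *ᵥ x = 0 → A *ᵥ x = 0) :
    0 ≤ (A * mlog A - A * mlog R - A + R).trace ∧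
      ((A * mlog A - A * mlog R - A + R).trace = 0 → A = R) := by
  have sA := psd_isSymm hA
  have sR := psd_isSymm hR
  obtain ⟨a, r, U, V, O, hU, hU', hV, hV', eA, eR, rfl, htr⟩ := exists_overlap sA sR
  set O := Uᵀ * V with hO
  have eAU : Uᵀ * A = Matrix.diagonal a * Uᵀ := by
    rw [eA, ← Matrix.mul_assoc, ← Matrix.mul_assoc, hU', Matrix.one_mul]
  have eRV : R * V = V * Matrix.diagonal r := by
    rw [eR, Matrix.mul_assoc, hV', Matrix.mul_one]
  have ha : ∀ i, 0 ≤ a i := by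
    have : (Uᵀ * A * U).PosSemidef := by
      have := hA.conjTranspose_mul_mul_same U
      rwa [Matrix.conjTranspose_eq_transpose_of_trivial] at this
    rw [eAU, Matrix.mul_assoc, hU', Matrix.mul_one] at this
    exact Matrix.posSemidef_diagonal_iff.1 this
  have hr : ∀ i, 0 ≤ r i := by
    have : (Vᵀ * R * V).PosSemidef := by
      have := hR.conjTranspose_mul_mul_same V
      rwa [Matrix.conjTranspose_eq_transpose_of_trivial] at this
    rw [Matrix.mul_assoc, eRV, ← Matrix.mul_assoc, hV', Matrix.one_mul] at this
    exact Matrix.posSemidef_diagonal_iff.1 this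
  -- The only use of the kernel inclusion: an eigenvector of R for the eigenvalue 0 is killed by A.
  -- The terms where log 0 is the default value 0 then vanish.
  have hz : ∀ i k, r k = 0 → a i * O i k = 0 := by
    intro i k hk
    have h1 : R *ᵥ (fun m => V m k) = 0 := by
      ext m
      have := congrFun (congrFun eRV m) k
      rw [Matrix.mul_diagonal, hk, mul_zero] at this
      exact this
    have h2 := hker _ h1
    have h3 : (Uᵀ * A * V) i k = 0 := by
      rw [Matrix.mul_assoc, Matrix.mul_apply]
      refine Finset.sum_eq_zero fun m _ => ?_
      have : (A * V) m k = 0 := congrFun h2 m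
      rw [this, mul_zero]
    rwa [eAU, Matrix.mul_assoc, ← hO, Matrix.diagonal_mul] at h3
  have e : (A * mlog A - A * mlog R - A + R).trace =
      ∑ i, ∑ k, (a i * Real.log (a i) - a i * Real.log (r k) - a i + r k) * O i k ^ 2 := by
    have t1 := htr (fun x => x * Real.log x) (fun _ => 1)
    have t2 := htr (fun x => x) Real.log
    have t3 := htr (fun x => x) (fun _ => 1)
    have t4 := htr (fun _ => 1) (fun x => x)
    rw [cfc_one_eq sR, ← mul_mlog_eq sA, Matrix.mul_one] at t1
    rw [cfc_id_eq sA] at t2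
    rw [cfc_id_eq sA, cfc_one_eq sR, Matrix.mul_one] at t3
    rw [cfc_one_eq sA, cfc_id_eq sR, Matrix.one_mul] at t4
    rw [Matrix.trace_add, Matrix.trace_sub, Matrix.trace_sub, t1, mlog, t2, t3, t4]
    simp only [← Finset.sum_sub_distrib, ← Finset.sum_add_distrib]
    refine Finset.sum_congr rfl fun i _ => Finset.sum_congr rfl fun k _ => ?_
    ring
  have hnn : ∀ i k,
      0 ≤ (a i * Real.log (a i) - a i * Real.log (r k) - a i + r k) * O i k ^ 2 := by
    intro i k
    rcases (hr k).eq_or_lt with h | h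
    · rcases mul_eq_zero.1 (hz i k h.symm) with h' | h'
      · rw [← h, h']; simp
      · rw [h']; simp
    · exact mul_nonneg (klein_scalar (ha i) h).1 (sq_nonneg _)
  rw [e]
  refine ⟨Finset.sum_nonneg fun i _ => Finset.sum_nonneg fun k _ => hnn i k, fun h0 => ?_⟩
  -- In the equality case each term vanishes, so eigenvectors of A and R with nonzero overlap share
  -- their eigenvalue. In matrix form this says that O intertwines the two diagonal matrices.
  have h1 : ∀ i k, a i * O i k = O i k * r k := by
    intro i k
    have h2 := (Finset.sum_eq_zero_iff_of_nonneg
      (fun i _ => Finset.sum_nonneg fun k _ => hnn i k)).1 h0 i (Finset.mem_univ _)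
    have h3 := (Finset.sum_eq_zero_iff_of_nonneg (fun k _ => hnn i k)).1 h2 k (Finset.mem_univ _)
    rcases (hr k).eq_or_lt with h | h
    · rw [hz i k h.symm, ← h, mul_zero]
    · rcases mul_eq_zero.1 h3 with h' | h'
      · rw [(klein_scalar (ha i) h).2 h', mul_comm]
      · rw [pow_eq_zero_iff two_ne_zero] at h'
        rw [h']; simp
  have h2 : Matrix.diagonal a * O = O * Matrix.diagonal r := by
    ext i k
    rw [Matrix.diagonal_mul, Matrix.mul_diagonal, h1]
  calc A = U * (Matrix.diagonal a * O) * Vᵀ := by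
        rw [hO, eA]
        simp only [Matrix.mul_assoc]
        rw [hV, Matrix.mul_one]
    _ = R := by
        rw [h2, hO, eR]
        simp only [← Matrix.mul_assoc]
        rw [hU, Matrix.one_mul]

end

section

variable {d : ℕ}

/-! ### The matrices `exp (u + log Q)` -/

theorem isSymm_rangeProj (Q : Mat d) : (rangeProj Q).IsSymm := isSymm_cfc _ _
theorem isSymm_mlog (Q : Mat d) : (mlog Q).IsSymm := isSymm_cfc _ _

/-- The exponent in `expAddLog u Q`. -/
def expo (u Q : Mat d) : Mat d := rangeProj Q * u * rangeProj Q + mlog Q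

theorem isSymm_expo {u : Mat d} (hu : u.IsSymm) (Q : Mat d) : (expo u Q).IsSymm :=
  (isSymm_conj (isSymm_rangeProj Q) hu).add (isSymm_mlog Q)

theorem rangeProj_mul_self {Q : Mat d} (hQ : Q.IsSymm) :
    rangeProj Q * rangeProj Q = rangeProj Q :=
  ext_of_eigen hQ fun x t hx => by
    rw [rangeProj, ← Matrix.mulVec_mulVec, cfc_mulVec_of_eigen hQ _ hx, Matrix.mulVec_smul,
      cfc_mulVec_of_eigen hQ _ hx, smul_smul]
    split_ifs <;> simp

theorem mul_rangeProj {Q : Mat d} (hQ : Q.IsSymm) : Q * rangeProj Q = Q :=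
  ext_of_eigen hQ fun x t hx => by
    rw [rangeProj, ← Matrix.mulVec_mulVec, cfc_mulVec_of_eigen hQ _ hx, Matrix.mulVec_smul, hx]
    split_ifs with h <;> simp [h]

theorem mlog_mul_rangeProj {Q : Mat d} (hQ : Q.IsSymm) : mlog Q * rangeProj Q = mlog Q :=
  ext_of_eigen hQ fun x t hx => by
    rw [rangeProj, mlog, ← Matrix.mulVec_mulVec, cfc_mulVec_of_eigen hQ _ hx, Matrix.mulVec_smul,
      cfc_mulVec_of_eigen hQ _ hx]
    split_ifs with h <;> simp [h]

theorem rangeProj_mul_mlog {Q : Mat d} (hQ : Q.IsSymm) : rangeProj Q * mlog Q = mlog Q := by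
  have := congrArg Matrix.transpose (mlog_mul_rangeProj hQ)
  rwa [Matrix.transpose_mul, (isSymm_mlog Q).eq, (isSymm_rangeProj Q).eq] at this

theorem expo_mul_rangeProj (u : Mat d) {Q : Mat d} (hQ : Q.IsSymm) :
    expo u Q * rangeProj Q = expo u Q := by
  rw [expo, Matrix.add_mul, Matrix.mul_assoc, rangeProj_mul_self hQ, mlog_mul_rangeProj hQ]

theorem rangeProj_mul_expo (u : Mat d) {Q : Mat d} (hQ : Q.IsSymm) :
    rangeProj Q * expo u Q = expo u Q := by
  rw [expo, Matrix.mul_add, ← Matrix.mul_assoc, ← Matrix.mul_assoc, rangeProj_mul_self hQ,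
    rangeProj_mul_mlog hQ]

theorem rangeProj_mulVec_eigen {u Q : Mat d} (hQ : Q.IsSymm) {x : Fin d → ℝ} {t : ℝ}
    (hx : expo u Q *ᵥ x = t • x) :
    expo u Q *ᵥ (rangeProj Q *ᵥ x) = t • (rangeProj Q *ᵥ x) := by
  rw [Matrix.mulVec_mulVec, expo_mul_rangeProj u hQ, ← Matrix.mulVec_smul, ← hx,
    Matrix.mulVec_mulVec, rangeProj_mul_expo u hQ]

theorem expAddLog_mulVec_of_eigen {u Q : Mat d} (hu : u.IsSymm) (hQ : Q.IsSymm)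
    {x : Fin d → ℝ} {t : ℝ} (hx : expo u Q *ᵥ x = t • x) :
    expAddLog u Q *ᵥ x = Real.exp t • (rangeProj Q *ᵥ x) := by
  have h : expAddLog u Q = rangeProj Q * mexp (expo u Q) * rangeProj Q := rfl
  rw [h, ← Matrix.mulVec_mulVec, ← Matrix.mulVec_mulVec, mexp,
    cfc_mulVec_of_eigen (isSymm_expo hu Q) _ (rangeProj_mulVec_eigen hQ hx), Matrix.mulVec_smul,
    Matrix.mulVec_mulVec, rangeProj_mul_self hQ]

theorem psd_expAddLog {u : Mat d} (hu : u.IsSymm) (Q : Mat d) : (expAddLog u Q).PosSemidef := by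
  have := (psd_cfc (fun x => (Real.exp_pos x).le)
    (isSymm_expo hu Q)).mul_mul_conjTranspose_same (rangeProj Q)
  rwa [Matrix.conjTranspose_eq_transpose_of_trivial, (isSymm_rangeProj Q).eq] at this

theorem psd_mexp {u : Mat d} (hu : u.IsSymm) : (mexp u).PosSemidef :=
  psd_cfc (fun x => (Real.exp_pos x).le) hu

/-- An eigenvector of the exponent splits into its projection on the range of Q, where log inverts
exp, and a remainder killed by both sides thanks to log 0 = 0. -/
theorem mlog_expAddLog {u Q : Mat d} (hu : u.IsSymm) (hQ : Q.IsSymm) :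
    mlog (expAddLog u Q) = expo u Q := by
  refine ext_of_eigen (isSymm_expo hu Q) fun x t hx => ?_
  have sR : (expAddLog u Q).IsSymm := psd_isSymm (psd_expAddLog hu Q)
  have h1 : expAddLog u Q *ᵥ (rangeProj Q *ᵥ x) = Real.exp t • (rangeProj Q *ᵥ x) := by
    rw [expAddLog_mulVec_of_eigen hu hQ (rangeProj_mulVec_eigen hQ hx), Matrix.mulVec_mulVec,
      rangeProj_mul_self hQ]
  have h2 : expAddLog u Q *ᵥ (x - rangeProj Q *ᵥ x) = (0 : ℝ) • (x - rangeProj Q *ᵥ x) := by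
    rw [Matrix.mulVec_sub, h1, expAddLog_mulVec_of_eigen hu hQ hx, sub_self, zero_smul]
  have h3 := cfc_mulVec_of_eigen sR Real.log h1
  have h4 := cfc_mulVec_of_eigen sR Real.log h2
  rw [Real.log_exp] at h3
  rw [Real.log_zero, zero_smul, Matrix.mulVec_sub, h3, sub_eq_zero] at h4
  rw [mlog, h4, ← rangeProj_mulVec_eigen hQ hx, Matrix.mulVec_mulVec, expo_mul_rangeProj u hQ]

theorem mulVec_eq_zero_of_expAddLog {u Q : Mat d} (hu : u.IsSymm) (hQ : Q.IsSymm)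
    {x : Fin d → ℝ} (hx : expAddLog u Q *ᵥ x = 0) : Q *ᵥ x = 0 := by
  have e : mexp (-expo u Q) * expAddLog u Q = rangeProj Q := by
    refine ext_of_eigen (isSymm_expo hu Q) fun x t hx => ?_
    have h1 : (-expo u Q) *ᵥ (rangeProj Q *ᵥ x) = (-t) • (rangeProj Q *ᵥ x) := by
      rw [Matrix.neg_mulVec, rangeProj_mulVec_eigen hQ hx, neg_smul]
    rw [← Matrix.mulVec_mulVec, expAddLog_mulVec_of_eigen hu hQ hx, Matrix.mulVec_smul, mexp,
      cfc_mulVec_of_eigen (isSymm_expo hu Q).neg _ h1, smul_smul, ← Real.exp_add, add_neg_cancel,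
      Real.exp_zero, one_smul]
  have h2 : rangeProj Q *ᵥ x = 0 := by
    rw [← e, ← Matrix.mulVec_mulVec, hx, Matrix.mulVec_zero]
  rw [← mul_rangeProj hQ, ← Matrix.mulVec_mulVec, h2, Matrix.mulVec_zero]

theorem expAddLog_mulVec_eq_zero {u Q : Mat d} (hQ : Q.IsSymm)
    {x : Fin d → ℝ} (hx : Q *ᵥ x = 0) : expAddLog u Q *ᵥ x = 0 := by
  have h : rangeProj Q *ᵥ x = 0 := by
    rw [rangeProj, cfc_mulVec_of_eigen hQ (t := 0) _ (by rw [hx, zero_smul])]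
    simp
  rw [expAddLog, ← Matrix.mulVec_mulVec, h, Matrix.mulVec_zero]

theorem rangeProj_one : rangeProj (1 : Mat d) = 1 :=
  ext_of_eigen Matrix.isSymm_one fun x t _ => by
    rw [rangeProj, cfc_mulVec_of_eigen Matrix.isSymm_one (t := 1) _ (by simp)]
    simp

theorem mlog_one : mlog (1 : Mat d) = 0 :=
  ext_of_eigen Matrix.isSymm_one fun x t _ => by
    rw [mlog, cfc_mulVec_of_eigen Matrix.isSymm_one (t := 1) _ (by simp)]
    simp

theorem expAddLog_one (u : Mat d) : expAddLog u 1 = mexp u := by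
  rw [expAddLog, rangeProj_one, mlog_one]; simp

theorem mexp_sub_smul_one {X : Mat d} (hX : X.IsSymm) (s : ℝ) :
    mexp (X - s • (1 : Mat d)) = Real.exp (-s) • mexp X :=
  ext_of_eigen hX fun x t hx => by
    have h : (X - s • (1 : Mat d)) *ᵥ x = (t - s) • x := by
      rw [Matrix.sub_mulVec, hx, Matrix.smul_mulVec, Matrix.one_mulVec, sub_smul]
    rw [Matrix.smul_mulVec, mexp, mexp,
      cfc_mulVec_of_eigen (hX.sub (Matrix.isSymm_one.smul s)) _ h, cfc_mulVec_of_eigen hX _ hx,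
      smul_smul, ← Real.exp_add]
    congr 2
    ring

/-! ### Variational formula for the relative entropy -/

/-- `ker Q ⊆ ker P`. -/
def KerLE (Q P : Mat d) : Prop := ∀ x : Fin d → ℝ, Q *ᵥ x = 0 → P *ᵥ x = 0

/-- The finite values of the relative entropy. -/
def relEnt (P Q : Mat d) : ℝ := (P * mlog P - P * mlog Q - P + Q).trace

theorem mul_rangeProj_of_kerLE {P Q : Mat d} (hQ : Q.IsSymm) (h : KerLE Q P) :
    P * rangeProj Q = P :=
  ext_of_eigen hQ fun x t hx => by
    rw [rangeProj, ← Matrix.mulVec_mulVec, cfc_mulVec_of_eigen hQ _ hx, Matrix.mulVec_smul]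
    split_ifs with h0
    · rw [h x (by rw [hx, h0, zero_smul]), smul_zero]
    · rw [one_smul]

theorem rangeProj_mul_of_kerLE {P Q : Mat d} (hP : P.IsSymm) (hQ : Q.IsSymm) (h : KerLE Q P) :
    rangeProj Q * P = P := by
  have := congrArg Matrix.transpose (mul_rangeProj_of_kerLE hQ h)
  rwa [Matrix.transpose_mul, hP.eq, (isSymm_rangeProj Q).eq] at this

theorem trace_mul_expo {P u Q : Mat d} (hP : P.IsSymm) (hQ : Q.IsSymm) (h : KerLE Q P) :
    (P * expo u Q).trace = (P * u).trace + (P * mlog Q).trace := by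
  rw [expo, Matrix.mul_add, Matrix.trace_add, ← Matrix.mul_assoc, ← Matrix.mul_assoc,
    mul_rangeProj_of_kerLE hQ h, Matrix.trace_mul_comm, ← Matrix.mul_assoc,
    rangeProj_mul_of_kerLE hP hQ h]

/-- The gap in the variational inequality is itself a relative entropy, so Klein's inequality
applies to it. The compression of u disappears from the trace because P lives on the range of Q. -/
theorem relEnt_sub_eq {P u Q : Mat d} (hP : P.IsSymm) (hQ : Q.IsSymm) (hu : u.IsSymm)
    (h : KerLE Q P) : (P * mlog P - P * mlog (expAddLog u Q) - P + expAddLog u Q).trace =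
      relEnt P Q - ((P * u).trace - (expAddLog u Q).trace + Q.trace) := by
  have := trace_mul_expo (u := u) hP hQ h
  rw [relEnt, mlog_expAddLog hu hQ]
  simp only [Matrix.trace_add, Matrix.trace_sub]
  linarith

theorem le_relEnt {P u Q : Mat d} (hP : P.PosSemidef) (hQ : Q.IsSymm) (hu : u.IsSymm)
    (h : KerLE Q P) : (P * u).trace - (expAddLog u Q).trace + Q.trace ≤ relEnt P Q := by
  have := (klein hP (psd_expAddLog hu Q) fun x hx => h x (mulVec_eq_zero_of_expAddLog hu hQ hx)).1
  rw [relEnt_sub_eq (psd_isSymm hP) hQ hu h] at this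
  linarith

theorem relEnt_expAddLog {u Q : Mat d} (hQ : Q.IsSymm) (hu : u.IsSymm) :
    relEnt (expAddLog u Q) Q =
      (expAddLog u Q * u).trace - (expAddLog u Q).trace + Q.trace := by
  have := relEnt_sub_eq (psd_isSymm (psd_expAddLog hu Q)) hQ hu
    fun x hx => expAddLog_mulVec_eq_zero (u := u) hQ hx
  rw [sub_self, zero_sub, neg_add_cancel, Matrix.trace_zero] at this
  linarith

theorem KerLE.rangeProj_eq {P Q : Mat d} (hQ : Q.IsSymm) (h : KerLE Q P)
    {x : Fin d → ℝ} {t : ℝ} (ht : t ≠ 0) (hP : P.IsSymm) (hx : P *ᵥ x = t • x) :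
    rangeProj Q *ᵥ x = x := by
  have : rangeProj Q *ᵥ (t • x) = t • x := by
    rw [← hx, Matrix.mulVec_mulVec, rangeProj_mul_of_kerLE hP hQ h]
  rw [Matrix.mulVec_smul] at this
  exact smul_right_injective _ ht this

/-- The formal optimizer log P - log Q fails when P is singular on the range of Q. The penalty -n on
ker P repairs it: e^{u_n + log Q} = P + e^{-n} E, where E is the difference of the two range
projectors, and the gap e^{-n} tr E tends to 0. -/
theorem exists_lt_of_lt_relEnt {P Q : Mat d} (hP : P.PosSemidef) (hQ : Q.PosSemidef)
    (h : KerLE Q P) {t : ℝ} (ht : t < relEnt P Q) :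
    ∃ u : Mat d, u.IsSymm ∧ t < (P * u).trace - (expAddLog u Q).trace + Q.trace := by
  have sP := psd_isSymm hP
  have sQ := psd_isSymm hQ
  set E := rangeProj Q - rangeProj P with hE
  let u : ℝ → Mat d := fun n => mlog P - mlog Q - n • (1 - rangeProj P)
  have hu : ∀ n, (u n).IsSymm := fun n => ((isSymm_mlog P).sub (isSymm_mlog Q)).sub
    ((Matrix.isSymm_one.sub (isSymm_rangeProj P)).smul n)
  have eR : ∀ n, expAddLog (u n) Q = P + Real.exp (-n) • E := by
    intro n
    have eB : expo (u n) Q = mlog P - n • E := by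
      have k1 : KerLE Q (mlog P) := fun x hx => by
        rw [mlog, cfc_mulVec_of_eigen sP (t := 0) _ (by rw [h x hx, zero_smul])]
        simp
      have k2 : KerLE Q (rangeProj P) := fun x hx => by
        rw [rangeProj, cfc_mulVec_of_eigen sP (t := 0) _ (by rw [h x hx, zero_smul])]
        simp
      have l1 := mul_rangeProj_of_kerLE sQ k1
      have l2 := rangeProj_mul_of_kerLE (isSymm_mlog P) sQ k1
      have l3 := mul_rangeProj_of_kerLE sQ k2
      have l4 := rangeProj_mul_of_kerLE (isSymm_rangeProj P) sQ k2
      simp only [expo, u, Matrix.mul_sub, Matrix.sub_mul, Matrix.mul_smul, Matrix.smul_mul, l2,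
        l1, l3, l4, rangeProj_mul_mlog sQ, mlog_mul_rangeProj sQ, Matrix.mul_one,
        rangeProj_mul_self sQ, hE]
      abel
    refine ext_of_eigen sP fun x t hx => ?_
    by_cases h0 : t = 0
    · subst h0
      have p1 : rangeProj P *ᵥ x = 0 := by
        rw [rangeProj, cfc_mulVec_of_eigen sP _ hx]; simp
      have q0 : P *ᵥ (rangeProj Q *ᵥ x) = (0 : ℝ) • (rangeProj Q *ᵥ x) := by
        rw [Matrix.mulVec_mulVec, mul_rangeProj_of_kerLE sQ h, hx, zero_smul, zero_smul]
      have q1 : rangeProj P *ᵥ (rangeProj Q *ᵥ x) = 0 := by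
        rw [rangeProj, cfc_mulVec_of_eigen sP _ q0]; simp
      have q2 : expo (u n) Q *ᵥ (rangeProj Q *ᵥ x) = (-n) • (rangeProj Q *ᵥ x) := by
        rw [eB, hE, Matrix.sub_mulVec, Matrix.smul_mulVec, Matrix.sub_mulVec, q1, sub_zero, mlog,
          cfc_mulVec_of_eigen sP _ q0, Real.log_zero, zero_smul, zero_sub, Matrix.mulVec_mulVec,
          rangeProj_mul_self sQ, neg_smul]
      have q3 : expAddLog (u n) Q *ᵥ x = expAddLog (u n) Q *ᵥ (rangeProj Q *ᵥ x) := by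
        simp only [expAddLog, Matrix.mulVec_mulVec, Matrix.mul_assoc, rangeProj_mul_self sQ]
      rw [q3, expAddLog_mulVec_of_eigen (hu n) sQ q2, Matrix.mulVec_mulVec, rangeProj_mul_self sQ,
        Matrix.add_mulVec, Matrix.smul_mulVec, hE, Matrix.sub_mulVec, p1, hx, zero_smul, zero_add,
        sub_zero]
    · rcases eq_or_ne x 0 with rfl | hx0
      · rw [Matrix.mulVec_zero, Matrix.mulVec_zero]
      have p1 : rangeProj P *ᵥ x = x := by
        rw [rangeProj, cfc_mulVec_of_eigen sP _ hx, if_neg h0, one_smul]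
      have p2 := KerLE.rangeProj_eq sQ h h0 sP hx
      have tpos : 0 < t := by
        have h1 := (psd_iff.1 hP).2 x
        rw [hx, dotProduct_smul, smul_eq_mul] at h1
        have h2 : 0 < x ⬝ᵥ x := by
          simpa using Matrix.dotProduct_star_self_pos_iff.2 hx0
        exact lt_of_le_of_ne (nonneg_of_mul_nonneg_left h1 h2) (Ne.symm h0)
      have q2 : expo (u n) Q *ᵥ x = Real.log t • x := by
        rw [eB, hE, Matrix.sub_mulVec, Matrix.smul_mulVec, Matrix.sub_mulVec, p1, p2, sub_self,
          smul_zero, sub_zero, mlog, cfc_mulVec_of_eigen sP _ hx]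
      rw [expAddLog_mulVec_of_eigen (hu n) sQ q2, Real.exp_log tpos, p2, Matrix.add_mulVec,
        Matrix.smul_mulVec, hE, Matrix.sub_mulVec, p1, p2, sub_self, smul_zero, add_zero, hx]
  have eT : ∀ n, (P * u n).trace - (expAddLog (u n) Q).trace + Q.trace =
      relEnt P Q - Real.exp (-n) * E.trace := by
    intro n
    have e1 : P * u n = P * mlog P - P * mlog Q := by
      simp only [u, Matrix.mul_sub, Matrix.mul_smul, Matrix.mul_one, mul_rangeProj sP, sub_self,
        smul_zero, sub_zero]
    rw [e1, eR, relEnt]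
    simp only [Matrix.trace_add, Matrix.trace_sub, Matrix.trace_smul, smul_eq_mul]
    ring
  have hlim : Filter.Tendsto (fun n : ℝ => relEnt P Q - Real.exp (-n) * E.trace) Filter.atTop
      (nhds (relEnt P Q - 0 * E.trace)) :=
    tendsto_const_nhds.sub (Real.tendsto_exp_neg_atTop_nhds_zero.mul tendsto_const_nhds)
  rw [zero_mul, sub_zero] at hlim
  obtain ⟨n, hn⟩ := (hlim.eventually (lt_mem_nhds ht)).exists
  exact ⟨u n, hu n, by rw [eT]; exact hn⟩

/-- Take x in ker Q but not in ker P, and u = s x xᵀ. The exponential does not see u, while tr(Pu)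
grows linearly in s. -/
theorem exists_lt_of_not_kerLE {P Q : Mat d} (hP : P.PosSemidef) (hQ : Q.PosSemidef)
    (h : ¬ KerLE Q P) (t : ℝ) :
    ∃ u : Mat d, u.IsSymm ∧ t < (P * u).trace - (expAddLog u Q).trace + Q.trace := by
  have sQ := psd_isSymm hQ
  simp only [KerLE, not_forall] at h
  obtain ⟨x, hx, hPx⟩ := h
  have hpos : 0 < x ⬝ᵥ (P *ᵥ x) :=
    lt_of_le_of_ne ((psd_iff.1 hP).2 x) fun h0 => hPx (psd_mulVec_eq_zero hP h0.symm)
  let X := Matrix.vecMulVec x x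
  have sX : X.IsSymm := by
    ext i j; simp [X, Matrix.vecMulVec_apply, mul_comm]
  have h0 : rangeProj Q *ᵥ x = 0 := by
    rw [rangeProj, cfc_mulVec_of_eigen sQ (t := 0) _ (by rw [hx, zero_smul])]
    simp
  have e1 : ∀ s : ℝ, expAddLog (s • X) Q = expAddLog 0 Q := by
    intro s
    have : rangeProj Q * (s • X) = 0 := by
      rw [Matrix.mul_smul, Matrix.mul_vecMulVec, h0, Matrix.zero_vecMulVec, smul_zero]
    rw [expAddLog, this, expAddLog, Matrix.mul_zero]
  have e2 : ∀ s : ℝ, (P * (s • X)).trace = s * (x ⬝ᵥ (P *ᵥ x)) := by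
    intro s
    rw [Matrix.mul_smul, Matrix.trace_smul, Matrix.mul_vecMulVec, Matrix.trace_vecMulVec,
      smul_eq_mul, dotProduct_comm]
  set D := -(expAddLog 0 Q).trace + Q.trace
  refine ⟨((t - D + 1) / (x ⬝ᵥ (P *ᵥ x))) • X, sX.smul _, ?_⟩
  rw [e1, e2, div_mul_cancel₀ _ hpos.ne']
  linarith

theorem KL_eq_of_kerLE {P Q : Mat d} (hP : P.PosSemidef) (h : KerLE Q P) :
    KL P Q = (relEnt P Q : EReal) := by
  rw [KL, if_pos ⟨hP, h⟩, relEnt]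

theorem KL_eq_top_of_not_kerLE {P Q : Mat d} (h : ¬ KerLE Q P) : KL P Q = ⊤ := by
  rw [KL, if_neg fun h' => h h'.2]

theorem le_KL {P u Q : Mat d} (hP : P.PosSemidef) (hQ : Q.IsSymm) (hu : u.IsSymm) :
    (((P * u).trace - (expAddLog u Q).trace + Q.trace : ℝ) : EReal) ≤ KL P Q := by
  by_cases h : KerLE Q P
  · rw [KL_eq_of_kerLE hP h]
    exact EReal.coe_le_coe_iff.2 (le_relEnt hP hQ hu h)
  · rw [KL_eq_top_of_not_kerLE h]
    exact le_top

theorem exists_lt_of_lt_KL {P Q : Mat d} (hP : P.PosSemidef) (hQ : Q.PosSemidef) {t : ℝ}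
    (ht : (t : EReal) < KL P Q) :
    ∃ u : Mat d, u.IsSymm ∧ t < (P * u).trace - (expAddLog u Q).trace + Q.trace := by
  by_cases h : KerLE Q P
  · rw [KL_eq_of_kerLE hP h] at ht
    exact exists_lt_of_lt_relEnt hP hQ h (EReal.coe_lt_coe_iff.1 ht)
  · exact exists_lt_of_not_kerLE hP hQ h t

/-! ### Negative entropy -/

/-- The negative entropy `tr (P log P - P)`. -/
def negEnt (P : Mat d) : ℝ := (P * mlog P - P).trace

theorem entropy_eq (P : Mat d) : entropy P = -negEnt P := rfl

theorem kerLE_one (P : Mat d) : KerLE 1 P := fun x hx => by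
  rw [Matrix.one_mulVec] at hx; rw [hx, Matrix.mulVec_zero]

theorem relEnt_one (P : Mat d) : relEnt P 1 = negEnt P + (1 : Mat d).trace := by
  rw [relEnt, negEnt, mlog_one, Matrix.mul_zero, sub_zero, Matrix.trace_add]

theorem relEnt_eq (P Q : Mat d) : relEnt P Q = negEnt P - (P * mlog Q).trace + Q.trace := by
  rw [relEnt, negEnt]
  simp only [Matrix.trace_add, Matrix.trace_sub]
  ring

theorem le_negEnt {P X : Mat d} (hP : P.PosSemidef) (hX : X.IsSymm) :
    (P * X).trace - (mexp X).trace ≤ negEnt P := by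
  have := le_relEnt hP Matrix.isSymm_one hX (kerLE_one P)
  rw [relEnt_one, expAddLog_one] at this
  linarith

theorem negEnt_mexp {X : Mat d} (hX : X.IsSymm) :
    negEnt (mexp X) = (mexp X * X).trace - (mexp X).trace := by
  have := relEnt_expAddLog Matrix.isSymm_one hX
  rw [relEnt_one, expAddLog_one] at this
  linarith

theorem exists_lt_of_lt_negEnt {P : Mat d} (hP : P.PosSemidef) {t : ℝ} (ht : t < negEnt P) :
    ∃ X : Mat d, X.IsSymm ∧ t < (P * X).trace - (mexp X).trace := by
  obtain ⟨u, hu, h⟩ := exists_lt_of_lt_relEnt hP Matrix.PosSemidef.one (kerLE_one P)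
    (t := t + (1 : Mat d).trace) (by rw [relEnt_one]; linarith)
  refine ⟨u, hu, ?_⟩
  rw [expAddLog_one] at h
  linarith

theorem convex_psd : Convex ℝ {P : Mat d | P.PosSemidef} := fun _ hP _ hQ _ _ ha hb _ =>
  (hP.smul ha).add (hQ.smul hb)

theorem continuous_trace_mul (X : Mat d) : Continuous fun P : Mat d => (P * X).trace :=
  (continuous_id.matrix_mul continuous_const).matrix_trace

/-- With M the midpoint, the convexity gap is the mean of KL(P|M) and KL(Q|M). If it vanished, P and
Q would both equal M by the equality case of Klein's inequality. -/
theorem negEnt_midpoint_lt {P Q : Mat d} (hP : P.PosSemidef) (hQ : Q.PosSemidef) (hne : P ≠ Q) :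
    negEnt ((1 / 2 : ℝ) • P + (1 / 2 : ℝ) • Q) < 1 / 2 * negEnt P + 1 / 2 * negEnt Q := by
  have half : (0 : ℝ) ≤ 1 / 2 := by norm_num
  set M := (1 / 2 : ℝ) • P + (1 / 2 : ℝ) • Q with hM
  have pM : M.PosSemidef := (hP.smul half).add (hQ.smul half)
  have ker : ∀ x : Fin d → ℝ, M *ᵥ x = 0 → P *ᵥ x = 0 ∧ Q *ᵥ x = 0 := by
    intro x hx
    have h1 := (psd_iff.1 hP).2 x
    have h2 := (psd_iff.1 hQ).2 x
    have h3 : x ⬝ᵥ (M *ᵥ x) = 1 / 2 * (x ⬝ᵥ (P *ᵥ x)) + 1 / 2 * (x ⬝ᵥ (Q *ᵥ x)) := by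
      rw [hM, Matrix.add_mulVec, Matrix.smul_mulVec, Matrix.smul_mulVec, dotProduct_add,
        dotProduct_smul, dotProduct_smul, smul_eq_mul, smul_eq_mul]
    rw [hx, dotProduct_zero] at h3
    exact ⟨psd_mulVec_eq_zero hP (by linarith), psd_mulVec_eq_zero hQ (by linarith)⟩
  have k1 := klein hP pM fun x hx => (ker x hx).1
  have k2 := klein hQ pM fun x hx => (ker x hx).2
  have e0 : M * mlog M = (1 / 2 : ℝ) • (P * mlog M) + (1 / 2 : ℝ) • (Q * mlog M) := by
    conv_lhs => rw [hM]
    rw [Matrix.add_mul, Matrix.smul_mul, Matrix.smul_mul]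
  have e : 1 / 2 * negEnt P + 1 / 2 * negEnt Q - negEnt M =
      1 / 2 * (P * mlog P - P * mlog M - P + M).trace +
        1 / 2 * (Q * mlog Q - Q * mlog M - Q + M).trace := by
    have eM : M.trace = 1 / 2 * P.trace + 1 / 2 * Q.trace := by
      rw [hM, Matrix.trace_add, Matrix.trace_smul, Matrix.trace_smul, smul_eq_mul, smul_eq_mul]
    simp only [negEnt, e0, Matrix.trace_add, Matrix.trace_sub, Matrix.trace_smul, smul_eq_mul, eM]
    ring
  by_contra hcon
  have z1 := k1.2 (by linarith [k1.1, k2.1])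
  have z2 := k2.2 (by linarith [k1.1, k2.1])
  exact hne (z1.trans z2.symm)

end

section

variable {d : ℕ}

/-! ### Sums of extended reals -/

theorem exists_real_lt_of_lt_add {x y : EReal} {t : ℝ} (h : (t : EReal) < x + y) :
    ∃ r s : ℝ, (r : EReal) < x ∧ (s : EReal) < y ∧ t < r + s := by
  by_contra! hcon
  refine absurd h (not_lt.2 (EReal.add_le_of_forall_lt fun a ha b hb => ?_))
  induction a with
  | bot => simp
  | top => simp at ha
  | coe r =>
    induction b with
    | bot => simp
    | top => simp at hb
    | coe s => exact_mod_cast hcon r s ha hb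

/-- Splits a real lower bound among the terms, so that near-optimal dual variables can be chosen
term by term even when some terms are +∞. -/
theorem exists_real_lt_of_lt_sum {ι : Type*} (S : Finset ι) {x : ι → EReal} {t : ℝ}
    (h : (t : EReal) < ∑ i ∈ S, x i) :
    ∃ r : ι → ℝ, (∀ i ∈ S, (r i : EReal) < x i) ∧ t < ∑ i ∈ S, r i := by
  classical
  induction S using Finset.induction_on generalizing t with
  | empty => exact ⟨fun _ => 0, by simp, by simpa using h⟩
  | insert a S ha ih =>
    rw [Finset.sum_insert ha] at h
    obtain ⟨p, q, hp, hq, hpq⟩ := exists_real_lt_of_lt_add h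
    obtain ⟨r, hr, hr'⟩ := ih hq
    refine ⟨Function.update r a p, fun i hi => ?_, ?_⟩
    · rcases eq_or_ne i a with rfl | hia
      · simpa using hp
      · rw [Function.update_of_ne hia]
        exact hr i ((Finset.mem_insert.1 hi).resolve_left hia)
    · rw [Finset.sum_insert ha, Function.update_self, Finset.sum_congr rfl fun i hi =>
        Function.update_of_ne (ne_of_mem_of_not_mem hi ha) p r]
      linarith

theorem coe_lt_mul_iff {w : ℝ} (hw : 0 < w) {x : EReal} {t : ℝ} :
    (t : EReal) < (w : EReal) * x ↔ ((t / w : ℝ) : EReal) < x := by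
  induction x with
  | bot => simp [EReal.coe_mul_bot_of_pos hw]
  | top => simp [EReal.coe_mul_top_of_pos hw, EReal.coe_lt_top]
  | coe r =>
    rw [← EReal.coe_mul, EReal.coe_lt_coe_iff, EReal.coe_lt_coe_iff, div_lt_iff₀ hw, mul_comm]

theorem coe_finset_sum {ι : Type*} (S : Finset ι) (f : ι → ℝ) :
    ((∑ i ∈ S, f i : ℝ) : EReal) = ∑ i ∈ S, (f i : EReal) := by
  classical
  induction S using Finset.induction_on with
  | empty => simp
  | insert a S ha ih => rw [Finset.sum_insert ha, Finset.sum_insert ha, EReal.coe_add, ih]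

/-! ### Convex lower semicontinuous functions -/

/-- Continuous affine maps. -/
structure ContAff {E F : Type*} [AddCommGroup E] [Module ℝ E] [TopologicalSpace E]
    [AddCommGroup F] [Module ℝ F] [TopologicalSpace F] (g : E → F) : Prop where
  cont : Continuous g
  aff : ∀ x y : E, ∀ a b : ℝ, a + b = 1 → g (a • x + b • y) = a • g x + b • g y

/-- Convex lower semicontinuous functions on a set. -/
structure ConvexLSC {E : Type*} [AddCommGroup E] [Module ℝ E] [TopologicalSpace E]
    (S : Set E) (f : E → ℝ) : Prop where
  convex : ConvexOn ℝ S f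
  lsc : LowerSemicontinuousOn f S

section
variable {E F : Type*} [AddCommGroup E] [Module ℝ E] [TopologicalSpace E]
    [AddCommGroup F] [Module ℝ F] [TopologicalSpace F] {S : Set E} {f g : E → ℝ}

theorem ConvexLSC.add (hf : ConvexLSC S f) (hg : ConvexLSC S g) :
    ConvexLSC S fun x => f x + g x :=
  ⟨hf.convex.add hg.convex, hf.lsc.add hg.lsc⟩

theorem ConvexLSC.const_mul (hf : ConvexLSC S f) {a : ℝ} (ha : 0 ≤ a) :
    ConvexLSC S fun x => a * f x :=
  ⟨hf.convex.smul ha, by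
    have h := (continuous_const_mul a).comp_lowerSemicontinuousOn hf.lsc
      (fun x y hxy => mul_le_mul_of_nonneg_left hxy ha)
    exact h⟩

theorem ConvexLSC.of_contAff (hS : Convex ℝ S) (hf : ContAff f) : ConvexLSC S f :=
  ⟨⟨hS, fun x _ y _ a b _ _ hab => (hf.aff x y a b hab).le⟩,
    hf.cont.lowerSemicontinuous.lowerSemicontinuousOn _⟩

theorem ConvexLSC.sum {ι : Type*} [Fintype ι] (hS : Convex ℝ S) {f : ι → E → ℝ}
    (hf : ∀ i, ConvexLSC S (f i)) : ConvexLSC S fun x => ∑ i, f i x := by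
  classical
  suffices ∀ T : Finset ι, ConvexLSC S fun x => ∑ i ∈ T, f i x from this Finset.univ
  intro T
  induction T using Finset.induction_on with
  | empty => simpa using ConvexLSC.of_contAff hS ⟨continuous_const, by simp⟩
  | insert a T ha ih => simpa only [Finset.sum_insert ha] using (hf a).add ih

theorem ConvexLSC.comp {T : Set F} (hf : ConvexLSC S f) {h : F → E} (hh : ContAff h)
    (hT : Convex ℝ T) (hm : Set.MapsTo h T S) : ConvexLSC T fun x => f (h x) :=
  ⟨⟨hT, fun x hx y hy a b ha hb hab => by
    simp only [hh.aff x y a b hab]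
    exact hf.convex.2 (hm hx) (hm hy) ha hb hab⟩, hf.lsc.comp hh.cont.continuousOn hm⟩

theorem ConvexLSC.mono {T : Set E} (hf : ConvexLSC S f) (h : T ⊆ S) (hT : Convex ℝ T) :
    ConvexLSC T f :=
  ⟨hf.convex.subset h hT, hf.lsc.mono h⟩

/-- The hypothesis says that f is the pointwise supremum of its continuous affine minorants on S. -/
theorem ConvexLSC.of_forall_lt (hS : Convex ℝ S)
    (h : ∀ x ∈ S, ∀ t < f x, ∃ a : E → ℝ, ContAff a ∧ (∀ y ∈ S, a y ≤ f y) ∧ t < a x) :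
    ConvexLSC S f := by
  refine ⟨⟨hS, fun x hx y hy a b ha hb hab => le_of_forall_lt fun t ht => ?_⟩, ?_⟩
  · obtain ⟨φ, hφ, hle, hlt⟩ := h _ (hS hx hy ha hb hab) t ht
    rw [hφ.aff x y a b hab] at hlt
    refine hlt.trans_le (add_le_add ?_ ?_)
    · exact mul_le_mul_of_nonneg_left (hle x hx) ha
    · exact mul_le_mul_of_nonneg_left (hle y hy) hb
  · rw [lowerSemicontinuousOn_iff]
    intro x hx
    rw [lowerSemicontinuousWithinAt_iff]
    intro t ht
    obtain ⟨φ, hφ, hle, hlt⟩ := h x hx t ht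
    filter_upwards [mem_nhdsWithin_of_mem_nhds (hφ.cont.continuousAt.eventually (lt_mem_nhds hlt)),
      self_mem_nhdsWithin] with y hy hy'
    exact hy.trans_le (hle y hy')

theorem ContAff.add {g h : E → ℝ} (hg : ContAff g) (hh : ContAff h) :
    ContAff fun x => g x + h x :=
  ⟨hg.cont.add hh.cont, fun x y a b hab => by
    rw [hg.aff x y a b hab, hh.aff x y a b hab]
    simp only [smul_eq_mul]; ring⟩

theorem ContAff.const (t : ℝ) : ContAff fun _ : E => t :=
  ⟨continuous_const, fun x y a b hab => by
    rw [smul_eq_mul, smul_eq_mul, ← add_mul, hab, one_mul]⟩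

theorem contAff_trace_mul (X : Mat d) : ContAff fun P : Mat d => (P * X).trace :=
  ⟨continuous_trace_mul X, fun x y a b _ => by
    rw [Matrix.add_mul, Matrix.smul_mul, Matrix.smul_mul, Matrix.trace_add, Matrix.trace_smul,
      Matrix.trace_smul]⟩

theorem contAff_trace_mul_left (X : Mat d) : ContAff fun P : Mat d => (X * P).trace := by
  simpa only [Matrix.trace_mul_comm X] using contAff_trace_mul X

end

theorem convex_isSymm : Convex ℝ {X : Mat d | X.IsSymm} := fun _ hP _ hQ a b _ _ _ =>
  (Matrix.IsSymm.smul hP a).add (Matrix.IsSymm.smul hQ b)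

theorem convexLSC_negEnt : ConvexLSC {P : Mat d | P.PosSemidef} negEnt :=
  .of_forall_lt convex_psd fun P hP t ht => by
    obtain ⟨X, hX, h⟩ := exists_lt_of_lt_negEnt hP ht
    exact ⟨fun P => (P * X).trace + -(mexp X).trace, (contAff_trace_mul X).add (.const _),
      fun Q hQ => by linarith [le_negEnt hQ hX], by linarith⟩

/-- The variational inequality read in the other direction: P = e^{u+log Q} gives an affine minorant
of the trace that touches it at u. -/
theorem convexLSC_trace_expAddLog {Q : Mat d} (hQ : Q.IsSymm) :
    ConvexLSC {u : Mat d | u.IsSymm} fun u => (expAddLog u Q).trace :=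
  .of_forall_lt convex_isSymm fun u hu t ht => by
    set P := expAddLog u Q with hP
    have e := relEnt_expAddLog hQ hu
    rw [← hP] at e
    refine ⟨fun v => (P * v).trace + (Q.trace - relEnt P Q),
      (contAff_trace_mul_left P).add (.const _), fun v hv => ?_, by linarith⟩
    have := le_relEnt (psd_expAddLog hu Q) hQ hv
      fun x hx => expAddLog_mulVec_eq_zero (u := u) hQ hx
    rw [← hP] at this
    linarith

theorem convexLSC_trace_mexp : ConvexLSC {u : Mat d | u.IsSymm} fun u => (mexp u).trace := by
  simpa only [expAddLog_one] using convexLSC_trace_expAddLog (Matrix.isSymm_one (n := Fin d))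

/-! ### Compactness -/

theorem psd_diag_nonneg {P : Mat d} (hP : P.PosSemidef) (a : Fin d) : 0 ≤ P a a := hP.diag_nonneg

theorem psd_abs_le_trace {P : Mat d} (hP : P.PosSemidef) (a b : Fin d) : |P a b| ≤ P.trace := by
  have hle : ∀ a, P a a ≤ P.trace := fun a =>
    Finset.single_le_sum (f := fun a => P a a) (fun i _ => psd_diag_nonneg hP i)
      (Finset.mem_univ a)
  have hs : P b a = P a b := (psd_isSymm hP).apply a b
  -- The quadratic form at e_a + s e_b; the values s = 1 and s = -1 bound the entry by the mean of
  -- two diagonal entries.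
  have key : ∀ s : ℝ, 0 ≤ P a a + 2 * s * P a b + s * s * P b b := by
    intro s
    have := (psd_iff.1 hP).2 (Pi.single a 1 + Pi.single b s)
    rw [Matrix.mulVec_add, add_dotProduct, dotProduct_add, dotProduct_add] at this
    simp only [Matrix.mulVec_single, single_dotProduct, Pi.smul_apply, Matrix.col_apply,
      MulOpposite.smul_eq_mul_unop, MulOpposite.unop_op, one_mul, mul_one, hs] at this
    linarith
  have k1 := key 1
  have k2 := key (-1)
  have h1 := hle a
  have h2 := hle b
  rw [abs_le]
  constructor <;> linarith

theorem isClosed_psd : IsClosed {P : Mat d | P.PosSemidef} := by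
  have : {P : Mat d | P.PosSemidef} =
      {P : Mat d | Pᵀ = P} ∩ ⋂ x : Fin d → ℝ, {P : Mat d | 0 ≤ x ⬝ᵥ (P *ᵥ x)} := by
    ext P
    simp only [Set.mem_ofPred_eq, psd_iff, Set.mem_inter_iff, Set.mem_iInter]
    rfl
  rw [this]
  refine (isClosed_eq continuous_id.matrix_transpose continuous_id).inter
    (isClosed_iInter fun x => isClosed_le continuous_const ?_)
  exact continuous_const.dotProduct (continuous_id.matrix_mulVec continuous_const)

theorem isClosed_isSymm : IsClosed {P : Mat d | P.IsSymm} :=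
  isClosed_eq continuous_id.matrix_transpose continuous_id

theorem isCompact_entries_le (T : ℝ) : IsCompact {P : Mat d | ∀ a b, |P a b| ≤ T} := by
  have h : IsCompact (Set.univ.pi fun _ : Fin d => Set.univ.pi fun _ : Fin d => Set.Icc (-T) T) :=
    isCompact_univ_pi fun _ => isCompact_univ_pi fun _ => isCompact_Icc
  have e : {P : Mat d | ∀ a b, |P a b| ≤ T} =
      (Set.univ.pi fun _ : Fin d => Set.univ.pi fun _ : Fin d => Set.Icc (-T) T) := by
    ext P
    exact ⟨fun h a _ b _ => abs_le.1 (h a b), fun h a b => abs_le.2 (h a trivial b trivial)⟩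
  rw [e]
  exact h

theorem isCompact_psd_trace_le (T : ℝ) :
    IsCompact {P : Mat d | P.PosSemidef ∧ P.trace ≤ T} := by
  refine (isCompact_entries_le (d := d) T).of_isClosed_subset
    (isClosed_psd.inter (isClosed_le continuous_id.matrix_trace continuous_const)) ?_
  exact fun P hP a b => (psd_abs_le_trace hP.1 a b).trans hP.2

theorem psd_eq_zero_of_trace {P : Mat d} (hP : P.PosSemidef) (h : P.trace ≤ 0) : P = 0 := by
  ext a b
  have := (psd_abs_le_trace hP a b).trans h
  simpa using this

/-! ### Minimax -/

/-- Sion's minimax theorem for real functions, as a uniform lower bound. -/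
theorem exists_forall_lt_of_forall_exists_lt {E F : Type*}
    [AddCommGroup E] [Module ℝ E] [TopologicalSpace E] [IsTopologicalAddGroup E]
    [ContinuousSMul ℝ E] [AddCommGroup F] [Module ℝ F] [TopologicalSpace F]
    [IsTopologicalAddGroup F] [ContinuousSMul ℝ F] {X : Set E} {Y : Set F} {f : E → F → ℝ}
    (hne : X.Nonempty) (hX : IsCompact X) (cX : Convex ℝ X) (cY : Convex ℝ Y)
    (h1 : ∀ y ∈ Y, ConvexLSC X fun x => f x y) (h2 : ∀ x ∈ X, ConvexLSC Y fun y => -f x y)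
    {t : ℝ} (ht : ∀ x ∈ X, ∃ y ∈ Y, t < f x y) : ∃ y ∈ Y, ∀ x ∈ X, t < f x y := by
  have hlsc : ∀ y ∈ Y, LowerSemicontinuousOn (fun x => f x y) X := fun y hy => (h1 y hy).lsc
  -- Compactness of X leaves finitely many y that already beat t at every x, which is the form in
  -- which Sion's theorem is applied.
  obtain ⟨u, hu⟩ := (LowerSemicontinuousOn.inter_biInter_preimage_Iic_eq_empty_iff_exists_finset
    (f := fun y x => f x y) hX (I := Y) (c := t) hlsc).1 (by
      rw [Set.eq_empty_iff_forall_notMem]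
      rintro x ⟨hx, hx'⟩
      obtain ⟨y, hy, hlt⟩ := ht x hx
      simp only [Set.mem_iInter, Set.mem_preimage, Set.mem_Iic] at hx'
      exact absurd hlt (not_lt.2 (hx' y hy)))
  refine Sion.exists_lt_iInf_of_lt_iInf_of_finite (s := Subtype.val '' (u : Set Y)) hne hX hlsc
    (fun y hy => (h1 y hy).convex.quasiconvexOn) cY ?_ ?_ cX
    (u.finite_toSet.image _) ?_ ?_
  · intro x hx y hy t' ht'
    have := (h2 x hx).lsc y hy (-t') (by simpa using ht')
    filter_upwards [this] with z hz
    simpa using hz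
  · intro x hx
    have := (h2 x hx).convex.neg.quasiconcaveOn
    have e : (-fun y => -f x y) = fun y => f x y := by ext y; simp
    rwa [e] at this
  · rintro _ ⟨y, -, rfl⟩
    exact y.2
  · intro x hx
    obtain ⟨y, hy, hlt⟩ := hu x hx
    exact ⟨y, ⟨y, hy, rfl⟩, hlt⟩

end

section

variable {d : ℕ} {I J : Type*}

/-! ### Duality for the transport problem with a fixed second marginal -/

/-- Pairs of collections of symmetric matrices. -/
def symPairs (d : ℕ) (I J : Type*) : Set ((I → Mat d) × (J → Mat d)) :=
  {p | (∀ i, (p.1 i).IsSymm) ∧ ∀ j, (p.2 j).IsSymm}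

theorem convex_symPairs : Convex ℝ (symPairs d I J) := fun _ hp _ hq a b _ _ _ =>
  ⟨fun i => ((hp.1 i).smul a).add ((hq.1 i).smul b),
    fun j => ((hp.2 j).smul a).add ((hq.2 j).smul b)⟩

variable {c : I → J → Mat d} {ρ ε : ℝ}

theorem isSymm_kern (hc : ∀ i j, (c i j).IsSymm) {u : I → Mat d} {v : J → Mat d}
    (hu : ∀ i, (u i).IsSymm) (hv : ∀ j, (v j).IsSymm) (i : I) (j : J) :
    (kern c ρ ε u v i j).IsSymm :=
  ((((hc i j).add ((hu i).smul ρ)).add (hv j)).smul ε⁻¹).neg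

theorem trace_mul_kern (hε : 0 < ε) (P : Mat d) (u : I → Mat d) (v : J → Mat d) (i : I) (j : J) :
    ε * (P * kern c ρ ε u v i j).trace = -(P * (c i j + ρ • u i + v j)).trace := by
  rw [kern, Matrix.mul_neg, Matrix.mul_smul, Matrix.trace_neg, Matrix.trace_smul, smul_eq_mul,
    mul_neg, mul_inv_cancel_left₀ hε.ne']

theorem kern_shift (hε : 0 < ε) (u : I → Mat d) (v : J → Mat d) (m : J → ℝ) (i : I) (j : J) :
    kern c ρ ε u (fun j => v j + (ε * m j) • (1 : Mat d)) i j =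
      kern c ρ ε u v i j - m j • (1 : Mat d) := by
  simp only [kern, smul_add, smul_smul, inv_mul_cancel_left₀ hε.ne']
  abel

theorem convex_psdPlans : Convex ℝ {γ : I → J → Mat d | ∀ i j, (γ i j).PosSemidef} :=
  fun _ hγ _ hη _ _ ha hb _ i j => ((hγ i j).smul ha).add ((hη i j).smul hb)

theorem isClosed_psdPlans : IsClosed {γ : I → J → Mat d | ∀ i j, (γ i j).PosSemidef} := by
  have h : {γ : I → J → Mat d | ∀ i j, (γ i j).PosSemidef} =
      ⋂ i, ⋂ j, (fun γ : I → J → Mat d => γ i j) ⁻¹' {P | P.PosSemidef} := by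
    ext γ; simp
  rw [h]
  exact isClosed_iInter fun i => isClosed_iInter fun j => isClosed_psd.preimage (by fun_prop)

theorem isCompact_of_plans {K : Set (I → J → Mat d)} (hK : IsClosed K) (T : ℝ)
    (h : ∀ γ ∈ K, ∀ i j, (γ i j).PosSemidef ∧ (γ i j).trace ≤ T) : IsCompact K := by
  have h' : IsCompact (Set.univ.pi fun _ : I => Set.univ.pi fun _ : J =>
      {P : Mat d | P.PosSemidef ∧ P.trace ≤ T}) :=
    isCompact_univ_pi fun _ => isCompact_univ_pi fun _ => isCompact_psd_trace_le T
  exact h'.of_isClosed_subset hK fun γ hγ i _ j _ => h γ hγ i j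

variable [Fintype I]

/-- Collections of positive semidefinite matrices whose second marginal has trace at most `T`. -/
def boundedPlans (I : Type*) [Fintype I] (d : ℕ) (T : J → ℝ) : Set (I → J → Mat d) :=
  {γ | (∀ i j, (γ i j).PosSemidef) ∧ ∀ j, ∑ i, (γ i j).trace ≤ T j}

theorem convex_boundedPlans (T : J → ℝ) : Convex ℝ (boundedPlans I d T) := by
  intro γ hγ η hη a b ha hb hab
  refine ⟨convex_psdPlans hγ.1 hη.1 ha hb hab, fun j => ?_⟩
  have h1 := mul_le_mul_of_nonneg_left (hγ.2 j) ha
  have h2 := mul_le_mul_of_nonneg_left (hη.2 j) hb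
  simp only [Pi.add_apply, Pi.smul_apply, Matrix.trace_add, Matrix.trace_smul, smul_eq_mul,
    Finset.sum_add_distrib, ← Finset.mul_sum]
  calc _ ≤ a * T j + b * T j := add_le_add h1 h2
    _ = T j := by rw [← add_mul, hab, one_mul]

variable [Fintype J]

/-- The Lagrangian of the transport problem, `u` being dual to the relative entropy and `v` to the
constraint on the second marginal. -/
def transportLagr (c : I → J → Mat d) (ρ ε : ℝ) (μ : I → Mat d) (ν : J → Mat d)
    (γ : I → J → Mat d) (p : (I → Mat d) × (J → Mat d)) : ℝ :=
  ∑ i, ∑ j, ((γ i j * (c i j + ρ • p.1 i + p.2 j)).trace + ε * negEnt (γ i j))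
    - ∑ j, (ν j * p.2 j).trace
    + ρ * ∑ i, ((μ i).trace - (expAddLog (p.1 i) (μ i)).trace)

/-- The dual objective of the transport problem. -/
def dualVal (c : I → J → Mat d) (ρ ε : ℝ) (μ : I → Mat d) (ν : J → Mat d)
    (p : (I → Mat d) × (J → Mat d)) : ℝ :=
  -(ρ * ∑ i, (expAddLog (p.1 i) (μ i)).trace + ∑ j, (ν j * p.2 j).trace
    + ε * ∑ i, ∑ j, (mexp (kern c ρ ε p.1 p.2 i j)).trace)

variable {μ : I → Mat d} {ν : J → Mat d}
  {γ : I → J → Mat d} {p : (I → Mat d) × (J → Mat d)}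

theorem dualVal_add_eq : ρ * ∑ i, (μ i).trace + dualVal c ρ ε μ ν p =
    ∑ i, ∑ j, -(ε * (mexp (kern c ρ ε p.1 p.2 i j)).trace)
    - ∑ j, (ν j * p.2 j).trace
    + ρ * ∑ i, ((μ i).trace - (expAddLog (p.1 i) (μ i)).trace) := by
  simp only [dualVal, Finset.sum_neg_distrib, Finset.sum_sub_distrib, Finset.mul_sum, mul_sub]
  ring

/-- Each block γ_ij is bounded separately by the Gibbs inequality with exponent K_ij: multiplied by
ε, the pairing with K_ij is minus the linear term of the Lagrangian. -/
theorem dualVal_le_transportLagr (hc : ∀ i j, (c i j).IsSymm) (hε : 0 < ε)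
    (hp : p ∈ symPairs d I J) (hγ : ∀ i j, (γ i j).PosSemidef) :
    ρ * ∑ i, (μ i).trace + dualVal c ρ ε μ ν p ≤ transportLagr c ρ ε μ ν γ p := by
  rw [dualVal_add_eq, transportLagr]
  gcongr with i _ j _
  have h1 := mul_le_mul_of_nonneg_left
    (le_negEnt (hγ i j) (isSymm_kern (ρ := ρ) (ε := ε) hc hp.1 hp.2 i j)) hε.le
  rw [mul_sub, trace_mul_kern hε] at h1
  linarith

theorem dualVal_eq_transportLagr (hc : ∀ i j, (c i j).IsSymm) (hε : 0 < ε)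
    (hp : p ∈ symPairs d I J) :
    ρ * ∑ i, (μ i).trace + dualVal c ρ ε μ ν p =
      transportLagr c ρ ε μ ν (fun i j => mexp (kern c ρ ε p.1 p.2 i j)) p := by
  rw [dualVal_add_eq, transportLagr]
  congr 2
  refine Finset.sum_congr rfl fun i _ => Finset.sum_congr rfl fun j _ => ?_
  rw [negEnt_mexp (isSymm_kern hc hp.1 hp.2 i j), mul_sub, trace_mul_kern hε]
  ring

theorem transportLagr_eq (hγ : ∀ j, ∑ i, γ i j = ν j) :
    transportLagr c ρ ε μ ν γ p = ∑ i, ∑ j, (γ i j * c i j).trace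
      + ρ * ∑ i, (((∑ j, γ i j) * p.1 i).trace - (expAddLog (p.1 i) (μ i)).trace + (μ i).trace)
      + ε * ∑ i, ∑ j, negEnt (γ i j) := by
  have h1 : ∑ j, (ν j * p.2 j).trace = ∑ i, ∑ j, (γ i j * p.2 j).trace := by
    rw [Finset.sum_comm]
    refine Finset.sum_congr rfl fun j _ => ?_
    rw [← hγ j, Finset.sum_mul, Matrix.trace_sum]
  rw [transportLagr, h1]
  simp only [Matrix.mul_smul, Matrix.trace_add, Matrix.trace_smul, smul_eq_mul,
    Finset.sum_add_distrib, Finset.sum_sub_distrib, Finset.mul_sum, Finset.sum_mul,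
    Matrix.trace_sum, mul_sub, mul_add]
  ring

theorem energy_eq (hc : ∀ i j, (c i j).IsSymm) : energy c ρ ε μ γ =
    ((∑ i, ∑ j, (γ i j * c i j).trace : ℝ) : EReal) + (ρ : EReal) * (∑ i, KL (∑ j, γ i j) (μ i))
      + ((ε * ∑ i, ∑ j, negEnt (γ i j) : ℝ) : EReal) := by
  have h1 : ∀ i j, (c i j)ᵀ = c i j := hc
  simp only [energy, h1, entropy_eq, Finset.sum_neg_distrib, mul_neg, neg_neg]

theorem couplings_psd_sum (hγ : γ ∈ couplings I ν) (i : I) : (∑ j, γ i j).PosSemidef :=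
  Matrix.posSemidef_sum _ fun j _ => hγ.1 i j

theorem transportLagr_le_energy (hc : ∀ i j, (c i j).IsSymm) (hρ : 0 < ρ)
    (hμ : ∀ i, (μ i).PosSemidef) (hp : p ∈ symPairs d I J) (hγ : γ ∈ couplings I ν) :
    (transportLagr c ρ ε μ ν γ p : EReal) ≤ energy c ρ ε μ γ := by
  have h : ((∑ i, (((∑ j, γ i j) * p.1 i).trace - (expAddLog (p.1 i) (μ i)).trace
      + (μ i).trace) : ℝ) : EReal) ≤ ∑ i, KL (∑ j, γ i j) (μ i) := by
    rw [coe_finset_sum]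
    exact Finset.sum_le_sum fun i _ =>
      le_KL (couplings_psd_sum hγ i) (psd_isSymm (hμ i)) (hp.1 i)
  rw [transportLagr_eq hγ.2, energy_eq hc, EReal.coe_add, EReal.coe_add, EReal.coe_mul]
  exact add_le_add (add_le_add le_rfl
    (mul_le_mul_of_nonneg_left h (EReal.coe_nonneg.2 hρ.le))) le_rfl

theorem exists_lt_transportLagr_of_lt_energy (hc : ∀ i j, (c i j).IsSymm) (hρ : 0 < ρ)
    (hμ : ∀ i, (μ i).PosSemidef) (hγ : γ ∈ couplings I ν) {t : ℝ}
    (ht : (t : EReal) < energy c ρ ε μ γ) :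
    ∃ u : I → Mat d, (∀ i, (u i).IsSymm) ∧ ∀ v, t < transportLagr c ρ ε μ ν γ (u, v) := by
  rw [energy_eq hc] at ht
  obtain ⟨r1, r2, h1, h2, h3⟩ := exists_real_lt_of_lt_add ht
  obtain ⟨s1, s2, k1, k2, k3⟩ := exists_real_lt_of_lt_add h1
  rw [EReal.coe_lt_coe_iff] at h2 k1
  rw [coe_lt_mul_iff hρ] at k2
  obtain ⟨r, hr, hr'⟩ := exists_real_lt_of_lt_sum _ k2
  choose u hu hu' using fun i =>
    exists_lt_of_lt_KL (couplings_psd_sum hγ i) (hμ i) (hr i (Finset.mem_univ i))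
  refine ⟨u, hu, fun v => ?_⟩
  rw [transportLagr_eq hγ.2]
  have h5 : ∑ i, r i ≤ ∑ i, (((∑ j, γ i j) * u i).trace - (expAddLog (u i) (μ i)).trace
      + (μ i).trace) := Finset.sum_le_sum fun i _ => (hu' i).le
  have h6 := hr'.trans_le h5
  rw [div_lt_iff₀ hρ, mul_comm] at h6
  simp only
  linarith

theorem dualVal_le_W (hc : ∀ i j, (c i j).IsSymm) (hρ : 0 < ρ) (hε : 0 < ε)
    (hμ : ∀ i, (μ i).PosSemidef) (hp : p ∈ symPairs d I J) :
    ((ρ * ∑ i, (μ i).trace + dualVal c ρ ε μ ν p : ℝ) : EReal) ≤ W c ρ ε μ ν :=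
  le_iInf₂ fun _ hγ => (EReal.coe_le_coe_iff.2 (dualVal_le_transportLagr hc hε hp hγ.1)).trans
    (transportLagr_le_energy hc hρ hμ hp hγ)

theorem trace_le_sum_trace {ι : Type*} [Fintype ι] {f : ι → Mat d} (hf : ∀ i, (f i).PosSemidef)
    (i : ι) : (f i).trace ≤ ∑ i, (f i).trace :=
  Finset.single_le_sum (f := fun i => (f i).trace) (fun i _ => (hf i).trace_nonneg)
    (Finset.mem_univ i)

theorem isCompact_boundedPlans (T : J → ℝ) : IsCompact (boundedPlans I d T) := by
  refine isCompact_of_plans (isClosed_psdPlans.inter ?_) (∑ j, |T j|) fun γ hγ i j =>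
    ⟨hγ.1 i j, ?_⟩
  · have e : {γ : I → J → Mat d | ∀ j, ∑ i, (γ i j).trace ≤ T j} =
        ⋂ j, {γ | ∑ i, (γ i j).trace ≤ T j} := by
      ext γ; simp
    change IsClosed {γ : I → J → Mat d | ∀ j, ∑ i, (γ i j).trace ≤ T j}
    rw [e]
    refine isClosed_iInter fun j => isClosed_le ?_ continuous_const
    fun_prop
  · calc (γ i j).trace ≤ ∑ i, (γ i j).trace := trace_le_sum_trace (fun i => hγ.1 i j) i
      _ ≤ T j := hγ.2 j
      _ ≤ |T j| := le_abs_self _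
      _ ≤ ∑ j, |T j| := Finset.single_le_sum (f := fun j => |T j|) (fun j _ => abs_nonneg _)
          (Finset.mem_univ j)

theorem convexLSC_transportLagr (hε : 0 < ε) :
    ConvexLSC {γ : I → J → Mat d | ∀ i j, (γ i j).PosSemidef}
      fun γ => transportLagr c ρ ε μ ν γ p := by
  have hev : ∀ i j, ContAff fun γ : I → J → Mat d => γ i j := fun i j =>
    ⟨by fun_prop, fun _ _ _ _ _ => rfl⟩
  have h1 : ∀ i j, ConvexLSC {γ : I → J → Mat d | ∀ i j, (γ i j).PosSemidef} fun γ =>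
      (γ i j * (c i j + ρ • p.1 i + p.2 j)).trace + ε * negEnt (γ i j) := fun i j =>
    ((ConvexLSC.of_contAff convex_univ (contAff_trace_mul _)).comp (hev i j) convex_psdPlans
      (fun _ _ => trivial)).add
      ((convexLSC_negEnt.comp (hev i j) convex_psdPlans fun γ hγ => hγ i j).const_mul hε.le)
  have h2 := (ConvexLSC.sum convex_psdPlans fun i => ConvexLSC.sum convex_psdPlans (h1 i)).add
    (.of_contAff convex_psdPlans (.const (- ∑ j, (ν j * p.2 j).trace
      + ρ * ∑ i, ((μ i).trace - (expAddLog (p.1 i) (μ i)).trace))))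
  convert h2 using 2
  rw [transportLagr]
  ring

theorem convexLSC_neg_transportLagr (hρ : 0 < ρ) (hμ : ∀ i, (μ i).PosSemidef) :
    ConvexLSC (symPairs d I J) fun p => -transportLagr c ρ ε μ ν γ p := by
  have hu : ∀ i, ContAff fun p : (I → Mat d) × (J → Mat d) => p.1 i := fun i =>
    ⟨by fun_prop, fun _ _ _ _ _ => rfl⟩
  have h1 := (ConvexLSC.sum convex_symPairs fun i => ((convexLSC_trace_expAddLog
    (psd_isSymm (hμ i))).comp (hu i) convex_symPairs
      fun p (hp : p ∈ symPairs d I J) => hp.1 i)).const_mul hρ.le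
  have h2 : ContAff fun p : (I → Mat d) × (J → Mat d) =>
      -(∑ i, ∑ j, ((γ i j * (c i j + ρ • p.1 i + p.2 j)).trace + ε * negEnt (γ i j)))
      + ∑ j, (ν j * p.2 j).trace - ρ * ∑ i, (μ i).trace := by
    refine ⟨by fun_prop, fun p q a b hab => ?_⟩
    obtain rfl : b = 1 - a := by linarith
    simp only [Prod.fst_add, Prod.snd_add, Prod.smul_fst, Prod.smul_snd, Pi.add_apply,
      Pi.smul_apply, Matrix.mul_add, Matrix.mul_smul, Matrix.trace_add, Matrix.trace_smul,
      smul_eq_mul, smul_add, Finset.sum_add_distrib, ← Finset.mul_sum]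
    ring
  convert h1.add (.of_contAff convex_symPairs h2) using 2
  simp only [transportLagr, Finset.sum_sub_distrib, mul_sub]
  ring

/-- Take v proportional to the defect D of the second marginal: the Lagrangian is affine along this
ray, with slope ∑ tr(D_j²) > 0. -/
theorem exists_lt_transportLagr_of_not_coupling (hν : ∀ j, (ν j).IsSymm)
    (hγ : ∀ i j, (γ i j).PosSemidef) (h : γ ∉ couplings I ν) (t : ℝ) :
    ∃ p ∈ symPairs d I J, t < transportLagr c ρ ε μ ν γ p := by
  classical
  have h' : ∃ j, ∑ i, γ i j ≠ ν j := by
    by_contra! hcon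
    exact h ⟨hγ, hcon⟩
  let D : J → Mat d := fun j => ∑ i, γ i j - ν j
  have sD : ∀ j, (D j).IsSymm := fun j =>
    (psd_isSymm (Matrix.posSemidef_sum _ fun i _ => hγ i j)).sub (hν j)
  have hnn : ∀ j, 0 ≤ (D j * D j).trace := fun j => by
    have := (Matrix.posSemidef_conjTranspose_mul_self (D j)).trace_nonneg
    rwa [Matrix.conjTranspose_eq_transpose_of_trivial, (sD j).eq] at this
  have hpos : 0 < ∑ j, (D j * D j).trace := by
    obtain ⟨j, hj⟩ := h'
    refine Finset.sum_pos' (fun j _ => hnn j) ⟨j, Finset.mem_univ j, ?_⟩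
    refine lt_of_le_of_ne (hnn j) fun h0 => hj ?_
    have h1 := (Matrix.trace_conjTranspose_mul_self_eq_zero_iff (A := D j)).1 (by
      rw [Matrix.conjTranspose_eq_transpose_of_trivial, (sD j).eq, ← h0])
    exact sub_eq_zero.1 h1
  have e : ∀ s : ℝ, transportLagr c ρ ε μ ν γ (0, fun j => s • D j) =
      transportLagr c ρ ε μ ν γ (0, 0) + s * ∑ j, (D j * D j).trace := by
    intro s
    have e1 : ∑ j, (D j * D j).trace =
        ∑ i, ∑ j, (γ i j * D j).trace - ∑ j, (ν j * D j).trace := by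
      rw [Finset.sum_comm, ← Finset.sum_sub_distrib]
      refine Finset.sum_congr rfl fun j _ => ?_
      rw [← Matrix.trace_sum, ← Finset.sum_mul, ← Matrix.trace_sub, ← Matrix.sub_mul]
    rw [e1]
    simp only [transportLagr, Matrix.mul_add, Matrix.mul_smul, Matrix.trace_add,
      Matrix.trace_smul, smul_eq_mul, Finset.sum_add_distrib, ← Finset.mul_sum, Pi.zero_apply,
      Matrix.mul_zero, Matrix.trace_zero, Finset.sum_const_zero]
    ring
  refine ⟨(0, fun j => ((t - transportLagr c ρ ε μ ν γ (0, 0) + 1) /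
    ∑ j, (D j * D j).trace) • D j), ⟨fun i => Matrix.isSymm_zero, fun j => (sD j).smul _⟩, ?_⟩
  rw [e, div_mul_cancel₀ _ hpos.ne']
  linarith

/-- A complementary slackness choice: no shift if the mass Z is admissible; otherwise m = log(Z/T),
which brings the mass down to exactly T ≥ t. -/
theorem exists_scalar_shift {Z T t : ℝ} (hT : 0 < T) (ht : t ≤ T) :
    ∃ m, 0 ≤ m ∧ Real.exp (-m) * Z ≤ T ∧ 0 ≤ m * (Real.exp (-m) * Z - t) := by
  rcases le_or_gt Z T with h | h
  · exact ⟨0, le_rfl, by simpa using h, by simp⟩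
  · have hpos : 0 < Z / T := div_pos (hT.trans h) hT
    have e : Real.exp (-Real.log (Z / T)) * Z = T := by
      rw [Real.exp_neg, Real.exp_log hpos, inv_div, div_mul_cancel₀ _ (hT.trans h).ne']
    have hm : 0 ≤ Real.log (Z / T) := Real.log_nonneg ((one_le_div hT).2 h.le)
    exact ⟨Real.log (Z / T), hm, e.le, by rw [e]; exact mul_nonneg hm (by linarith)⟩

/-- Strong duality for the transport problem. -/
theorem exists_lt_dualVal_of_lt_W (hc : ∀ i j, (c i j).IsSymm) (hρ : 0 < ρ) (hε : 0 < ε)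
    (hμ : ∀ i, (μ i).PosSemidef) (hν : ∀ j, (ν j).PosSemidef) {t : ℝ}
    (ht : (t : EReal) < W c ρ ε μ ν) :
    ∃ p ∈ symPairs d I J, t < ρ * ∑ i, (μ i).trace + dualVal c ρ ε μ ν p := by
  -- The extra 1 keeps T positive even where ν_j = 0, so that the mass can be rescaled to T.
  set T : J → ℝ := fun j => (ν j).trace + 1 with hT
  have hT0 : ∀ j, 0 < T j := fun j => by linarith [(hν j).trace_nonneg, hT]
  have hsub : boundedPlans I d T ⊆ {γ | ∀ i j, (γ i j).PosSemidef} := fun γ hγ => hγ.1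
  obtain ⟨p, hp, hlt⟩ := exists_forall_lt_of_forall_exists_lt (X := boundedPlans I d T)
    (Y := symPairs d I J) (f := transportLagr c ρ ε μ ν) (t := t)
    ⟨0, fun _ _ => Matrix.PosSemidef.zero, fun j => by simpa using (hT0 j).le⟩
    (isCompact_boundedPlans T) (convex_boundedPlans T) convex_symPairs
    (fun p _ => (convexLSC_transportLagr hε).mono hsub (convex_boundedPlans T))
    (fun γ _ => convexLSC_neg_transportLagr hρ hμ)
    (fun γ hγ => by
      by_cases h : γ ∈ couplings I ν
      · obtain ⟨u, hu, hu'⟩ := exists_lt_transportLagr_of_lt_energy hc hρ hμ h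
          (ht.trans_le (iInf₂_le γ h))
        exact ⟨(u, 0), ⟨hu, fun _ => Matrix.isSymm_zero⟩, hu' 0⟩
      · exact exists_lt_transportLagr_of_not_coupling (fun j => psd_isSymm (hν j)) hγ.1 h t)
  obtain ⟨u, v⟩ := p
  have hK : ∀ i j, (kern c ρ ε u v i j).IsSymm := isSymm_kern hc hp.1 hp.2
  -- The global minimizer e^{K(u,v)} may leave the compact set on which the bound t is known. Adding
  -- ε m_j to v_j multiplies its blocks by e^{-m_j}, which makes it admissible.
  choose m hm hm1 hm2 using fun j => exists_scalar_shift
    (Z := ∑ i, (mexp (kern c ρ ε u v i j)).trace) (t := (ν j).trace)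
    (hT0 j) (by simp [hT])
  set v' : J → Mat d := fun j => v j + (ε * m j) • (1 : Mat d) with hv'
  have hp' : (u, v') ∈ symPairs d I J :=
    ⟨hp.1, fun j => (hp.2 j).add (Matrix.isSymm_one.smul _)⟩
  set γ : I → J → Mat d := fun i j => mexp (kern c ρ ε u v' i j) with hγ
  have hγ' : ∀ i j, γ i j = Real.exp (-m j) • mexp (kern c ρ ε u v i j) := fun i j => by
    rw [hγ, ← mexp_sub_smul_one (hK i j), ← kern_shift hε]
  have htr : ∀ j, ∑ i, (γ i j).trace =
      Real.exp (-m j) * ∑ i, (mexp (kern c ρ ε u v i j)).trace := fun j => by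
    simp only [hγ', Matrix.trace_smul, smul_eq_mul, Finset.mul_sum]
  have hmem : γ ∈ boundedPlans I d T :=
    ⟨fun i j => psd_mexp (isSymm_kern hc hp'.1 hp'.2 i j), fun j => by rw [htr]; exact hm1 j⟩
  refine ⟨(u, v'), hp', (hlt γ hmem).trans_le ?_⟩
  rw [dualVal_eq_transportLagr hc hε hp']
  -- The added term is nonnegative by the choice of m, so the bound t survives the change of
  -- potentials.
  have e : transportLagr c ρ ε μ ν γ (u, v') = transportLagr c ρ ε μ ν γ (u, v) +
      ∑ j, ε * (m j * (∑ i, (γ i j).trace - (ν j).trace)) := by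
    have e1 : ∑ i, ∑ j, ε * (m j * (γ i j).trace) = ∑ j, ε * (m j * ∑ i, (γ i j).trace) := by
      rw [Finset.sum_comm]
      simp only [Finset.mul_sum]
    simp only [transportLagr, hv', Matrix.mul_add, Matrix.mul_smul, Matrix.mul_one,
      Matrix.trace_add, Matrix.trace_smul, smul_eq_mul, Finset.sum_add_distrib, e1, mul_sub,
      Finset.sum_sub_distrib, mul_assoc]
    ring
  rw [e]
  have : 0 ≤ ∑ j, ε * (m j * (∑ i, (γ i j).trace - (ν j).trace)) :=
    Finset.sum_nonneg fun j _ => mul_nonneg hε.le (by rw [htr]; exact hm2 j)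
  linarith

end

section

variable {d : ℕ} {I J Λ : Type*}

/-! ### The barycenter Lagrangian -/

theorem convex_psdFields : Convex ℝ (psdFields d J) := fun _ hν _ hη _ _ ha hb _ j =>
  ((hν j).smul ha).add ((hη j).smul hb)

theorem convex_dualVars : Convex ℝ (dualVars d I J Λ) := fun _ hp _ hq a b _ _ _ =>
  ⟨fun l i => ((hp.1 l i).smul a).add ((hq.1 l i).smul b),
    fun l j => ((hp.2 l j).smul a).add ((hq.2 l j).smul b)⟩

theorem dualVars_symPairs {p : (Λ → I → Mat d) × (Λ → J → Mat d)} (hp : p ∈ dualVars d I J Λ)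
    (l : Λ) : (p.1 l, p.2 l) ∈ symPairs d I J :=
  ⟨hp.1 l, hp.2 l⟩

theorem zero_mem_dualVars : (0 : (Λ → I → Mat d) × (Λ → J → Mat d)) ∈ dualVars d I J Λ :=
  ⟨fun _ _ => Matrix.isSymm_zero, fun _ _ => Matrix.isSymm_zero⟩

theorem zero_mem_psdFields : (0 : J → Mat d) ∈ psdFields d J := fun _ => Matrix.PosSemidef.zero

theorem isClosed_psdFields : IsClosed (psdFields d J) := by
  have h : psdFields d J = ⋂ j, (fun ν : J → Mat d => ν j) ⁻¹' {P | P.PosSemidef} := by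
    ext ν; simp [psdFields]
  rw [h]
  exact isClosed_iInter fun j => isClosed_psd.preimage (by fun_prop)

theorem isClosed_dualVars : IsClosed (dualVars d I J Λ) := by
  have h : dualVars d I J Λ =
      (⋂ l, ⋂ i, (fun p : (Λ → I → Mat d) × (Λ → J → Mat d) => p.1 l i) ⁻¹' {X | X.IsSymm}) ∩
      ⋂ l, ⋂ j, (fun p : (Λ → I → Mat d) × (Λ → J → Mat d) => p.2 l j) ⁻¹' {X | X.IsSymm} := by
    ext p; simp [dualVars]
  rw [h]
  exact (isClosed_iInter fun l => isClosed_iInter fun i => isClosed_isSymm.preimage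
    (by fun_prop)).inter (isClosed_iInter fun l => isClosed_iInter fun j =>
    isClosed_isSymm.preimage (by fun_prop))

theorem trace_mexp_kern_nonneg {c : I → J → Mat d} {ρ ε : ℝ}
    {p : (Λ → I → Mat d) × (Λ → J → Mat d)} (hc : ∀ i j, (c i j).IsSymm) (hp : p ∈ dualVars d I J Λ)
    (l : Λ) (i : I) (j : J) : 0 ≤ (mexp (kern c ρ ε (p.1 l) (p.2 l) i j)).trace :=
  (psd_mexp (isSymm_kern hc (hp.1 l) (hp.2 l) i j)).trace_nonneg

section
variable [Fintype J]

/-- Collections of positive semidefinite matrices with total trace at most `R`. -/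
def boundedFields (d : ℕ) (J : Type*) [Fintype J] (R : ℝ) : Set (J → Mat d) :=
  {ν | (∀ j, (ν j).PosSemidef) ∧ ∑ j, (ν j).trace ≤ R}

theorem convex_boundedFields (R : ℝ) : Convex ℝ (boundedFields d J R) := by
  intro ν hν η hη a b ha hb hab
  refine ⟨convex_psdFields hν.1 hη.1 ha hb hab, ?_⟩
  have h1 := mul_le_mul_of_nonneg_left hν.2 ha
  have h2 := mul_le_mul_of_nonneg_left hη.2 hb
  simp only [Pi.add_apply, Pi.smul_apply, Matrix.trace_add, Matrix.trace_smul, smul_eq_mul,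
    Finset.sum_add_distrib, ← Finset.mul_sum]
  calc _ ≤ a * R + b * R := add_le_add h1 h2
    _ = R := by rw [← add_mul, hab, one_mul]

theorem isCompact_boundedFields (R : ℝ) : IsCompact (boundedFields d J R) := by
  have h' : IsCompact (Set.univ.pi fun _ : J => {P : Mat d | P.PosSemidef ∧ P.trace ≤ R}) :=
    isCompact_univ_pi fun _ => isCompact_psd_trace_le R
  have hc : Continuous fun ν : J → Mat d => ∑ j, (ν j).trace := by fun_prop
  refine h'.of_isClosed_subset (isClosed_psdFields.inter (isClosed_le hc continuous_const))
    fun ν hν j _ => ⟨hν.1 j, ?_⟩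
  exact (trace_le_sum_trace hν.1 j).trans hν.2

theorem zero_mem_boundedFields {R : ℝ} (hR : 0 ≤ R) : (0 : J → Mat d) ∈ boundedFields d J R :=
  ⟨zero_mem_psdFields, by simpa using hR⟩

/-- The support function of the positive semidefinite collections of unit trace controls all
positive semidefinite collections. -/
theorem exists_support (V : J → Mat d) : ∃ s, 0 ≤ s ∧
    (∀ ν ∈ psdFields d J, ∑ j, (ν j * V j).trace ≤ s * ∑ j, (ν j).trace) ∧
    ∀ R, 0 ≤ R → ∃ ν ∈ boundedFields d J R, ∑ j, (ν j * V j).trace = R * s := by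
  have hcont : Continuous fun ν : J → Mat d => ∑ j, (ν j * V j).trace := by fun_prop
  obtain ⟨η, hη, hmax⟩ := (isCompact_boundedFields (d := d) (J := J) 1).exists_isMaxOn
    ⟨0, zero_mem_boundedFields zero_le_one⟩ hcont.continuousOn
  refine ⟨∑ j, (η j * V j).trace, ?_, fun ν hν => ?_, fun R hR => ?_⟩
  · have := hmax (zero_mem_boundedFields (d := d) (J := J) zero_le_one)
    simpa using this
  · have h0 : 0 ≤ ∑ j, (ν j).trace := Finset.sum_nonneg fun j _ => (hν j).trace_nonneg
    -- Zero total trace forces ν = 0; otherwise ν is normalized to unit trace and compared with the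
    -- maximizer η.
    rcases h0.eq_or_lt with h | h
    · have hz : ∀ j, ν j = 0 := fun j =>
        psd_eq_zero_of_trace (hν j) ((trace_le_sum_trace hν j).trans h.symm.le)
      simp [hz]
    · set τ := ∑ j, (ν j).trace with hτ
      have hm : (fun j => τ⁻¹ • ν j) ∈ boundedFields d J 1 :=
        ⟨fun j => (hν j).smul (inv_nonneg.2 h0), by
          simp only [Matrix.trace_smul, smul_eq_mul, ← Finset.mul_sum, ← hτ]
          rw [inv_mul_cancel₀ h.ne']⟩
      have := hmax hm
      simp only [Set.mem_ofPred_eq, Matrix.smul_mul, Matrix.trace_smul, smul_eq_mul,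
        ← Finset.mul_sum] at this
      rwa [inv_mul_le_iff₀ h, mul_comm] at this
  · refine ⟨fun j => R • η j, ⟨fun j => (hη.1 j).smul hR, ?_⟩, ?_⟩
    · simp only [Matrix.trace_smul, smul_eq_mul, ← Finset.mul_sum]
      exact mul_le_of_le_one_right hR hη.2
    · simp only [Matrix.smul_mul, Matrix.trace_smul, smul_eq_mul, ← Finset.mul_sum]

end

variable [Fintype Λ]

/-- The average `∑_ℓ w_ℓ v^ℓ_j` of the potentials. -/
def avgPot (w : Λ → ℝ) (v : Λ → J → Mat d) (j : J) : Mat d := ∑ l, w l • v l j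

variable [Fintype I]

/-- The part of the Lagrangian depending on the first potentials only. -/
def entPart (ρ : ℝ) (w : Λ → ℝ) (μ : Λ → I → Mat d) (u : Λ → I → Mat d) : ℝ :=
  ∑ l, w l * (ρ * ∑ i, (expAddLog (u l i) (μ l i)).trace)

theorem entPart_nonneg {ρ : ℝ} {w : Λ → ℝ} {μ : Λ → I → Mat d}
    {p : (Λ → I → Mat d) × (Λ → J → Mat d)} (hρ : 0 < ρ) (hw : ∀ l, 0 < w l) (hp : p ∈ dualVars d I J Λ) :
    0 ≤ entPart ρ w μ p.1 :=
  Finset.sum_nonneg fun l _ => mul_nonneg (hw l).le (mul_nonneg hρ.le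
    (Finset.sum_nonneg fun i _ => (psd_expAddLog (hp.1 l i) _).trace_nonneg))

variable [Fintype J]

/-- The part of the Lagrangian depending on the kernels. -/
def kernPart (c : I → J → Mat d) (ρ ε : ℝ) (w : Λ → ℝ)
    (p : (Λ → I → Mat d) × (Λ → J → Mat d)) : ℝ :=
  ∑ l, w l * (ε * ∑ i, ∑ j, (mexp (kern c ρ ε (p.1 l) (p.2 l) i j)).trace)

variable {c : I → J → Mat d} {ρ ε : ℝ} {w : Λ → ℝ} {μ : Λ → I → Mat d} {ν : J → Mat d}
  {p : (Λ → I → Mat d) × (Λ → J → Mat d)}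

theorem lagr_eq_sum_dualVal : lagr c ρ ε w μ ν p =
    ∑ l, w l * dualVal c ρ ε (μ l) ν (p.1 l, p.2 l) := by
  simp only [lagr, dualVal, Matrix.trace_add, Matrix.trace_smul, Matrix.trace_sum, smul_eq_mul,
    mul_neg, Finset.sum_neg_distrib]

theorem lagr_eq : lagr c ρ ε w μ ν p =
    -(entPart ρ w μ p.1 + kernPart c ρ ε w p) - ∑ j, (ν j * avgPot w p.2 j).trace := by
  have h : ∑ j, (ν j * avgPot w p.2 j).trace = ∑ l, w l * ∑ j, (ν j * p.2 l j).trace := by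
    simp only [avgPot, Finset.mul_sum, Matrix.mul_smul, Matrix.trace_sum,
      Matrix.trace_smul, smul_eq_mul]
    exact Finset.sum_comm
  rw [h]
  simp only [lagr, entPart, kernPart, Matrix.trace_add, Matrix.trace_smul, Matrix.trace_sum,
    smul_eq_mul, mul_add, Finset.sum_add_distrib]
  ring

theorem kernPart_nonneg (hc : ∀ i j, (c i j).IsSymm) (hε : 0 < ε) (hw : ∀ l, 0 < w l)
    (hp : p ∈ dualVars d I J Λ) : 0 ≤ kernPart c ρ ε w p :=
  Finset.sum_nonneg fun l _ => mul_nonneg (hw l).le (mul_nonneg hε.le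
    (Finset.sum_nonneg fun i _ => Finset.sum_nonneg fun j _ => trace_mexp_kern_nonneg hc hp l i j))

theorem contAff_lagr : ContAff fun ν : J → Mat d => lagr c ρ ε w μ ν p := by
  simp only [lagr_eq]
  refine ⟨by fun_prop, fun x y a b hab => ?_⟩
  obtain rfl : b = 1 - a := by linarith
  simp only [Pi.add_apply, Pi.smul_apply, Matrix.add_mul, Matrix.smul_mul, Matrix.trace_add,
    Matrix.trace_smul, smul_eq_mul, Finset.sum_add_distrib, ← Finset.mul_sum]
  ring

theorem convexLSC_neg_lagr (hc : ∀ i j, (c i j).IsSymm) (hρ : 0 < ρ) (hε : 0 < ε)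
    (hw : ∀ l, 0 < w l) (hμ : ∀ l i, (μ l i).PosSemidef) :
    ConvexLSC (dualVars d I J Λ) fun p => -lagr c ρ ε w μ ν p := by
  have hu : ∀ l i, ContAff fun p : (Λ → I → Mat d) × (Λ → J → Mat d) => p.1 l i := fun l i =>
    ⟨by fun_prop, fun _ _ _ _ _ => rfl⟩
  have hk : ∀ l i j, ContAff fun p : (Λ → I → Mat d) × (Λ → J → Mat d) =>
      kern c ρ ε (p.1 l) (p.2 l) i j := fun l i j => by
    refine ⟨by unfold kern; fun_prop, fun p q a b hab => ?_⟩
    obtain rfl : b = 1 - a := by linarith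
    simp only [kern, Prod.fst_add, Prod.snd_add, Prod.smul_fst, Prod.smul_snd, Pi.add_apply,
      Pi.smul_apply]
    module
  have h1 : ConvexLSC (dualVars d I J Λ) fun p => entPart ρ w μ p.1 :=
    .sum convex_dualVars fun l => ConvexLSC.const_mul (ConvexLSC.const_mul
      (.sum convex_dualVars fun i => (convexLSC_trace_expAddLog (psd_isSymm (hμ l i))).comp
        (hu l i) convex_dualVars fun p (hp : p ∈ dualVars d I J Λ) => hp.1 l i) hρ.le) (hw l).le
  have h2 : ConvexLSC (dualVars d I J Λ) fun p => kernPart c ρ ε w p :=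
    .sum convex_dualVars fun l => ConvexLSC.const_mul (ConvexLSC.const_mul
      (.sum convex_dualVars fun i => .sum convex_dualVars fun j => convexLSC_trace_mexp.comp
        (hk l i j) convex_dualVars fun p (hp : p ∈ dualVars d I J Λ) =>
          isSymm_kern hc (hp.1 l) (hp.2 l) i j) hε.le) (hw l).le
  have h3 : ContAff fun p : (Λ → I → Mat d) × (Λ → J → Mat d) =>
      ∑ j, (ν j * avgPot w p.2 j).trace := by
    refine ⟨by unfold avgPot; fun_prop, fun p q a b hab => ?_⟩
    simp only [avgPot, Prod.snd_add, Prod.smul_snd, Pi.add_apply,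
      Pi.smul_apply, smul_add, Finset.sum_add_distrib, Matrix.mul_add,
      Matrix.mul_smul, Matrix.trace_add, Matrix.trace_sum, Matrix.trace_smul, smul_eq_mul,
      Finset.mul_sum, mul_left_comm]
  convert (h1.add h2).add (.of_contAff convex_dualVars h3) using 2
  rw [lagr_eq]
  ring

/-! ### Strong duality -/

theorem sum_const_add_dualVal : ρ * ∑ l, w l * ∑ i, (μ l i).trace + lagr c ρ ε w μ ν p =
    ∑ l, w l * (ρ * ∑ i, (μ l i).trace + dualVal c ρ ε (μ l) ν (p.1 l, p.2 l)) := by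
  rw [lagr_eq_sum_dualVal, Finset.mul_sum]
  simp only [mul_add, Finset.sum_add_distrib, mul_left_comm]

theorem lagr_le_baryObjective (hc : ∀ i j, (c i j).IsSymm) (hρ : 0 < ρ) (hε : 0 < ε)
    (hw : ∀ l, 0 < w l) (hμ : ∀ l i, (μ l i).PosSemidef) (hp : p ∈ dualVars d I J Λ) :
    ((ρ * ∑ l, w l * ∑ i, (μ l i).trace : ℝ) : EReal) + (lagr c ρ ε w μ ν p : EReal) ≤
      baryObjective c ρ ε w μ ν := by
  rw [← EReal.coe_add, sum_const_add_dualVal, coe_finset_sum, baryObjective]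
  refine Finset.sum_le_sum fun l _ => ?_
  rw [EReal.coe_mul]
  exact mul_le_mul_of_nonneg_left (dualVal_le_W hc hρ hε (hμ l) (dualVars_symPairs hp l))
    (EReal.coe_nonneg.2 (hw l).le)

theorem exists_lt_lagr_of_lt_baryObjective (hc : ∀ i j, (c i j).IsSymm) (hρ : 0 < ρ)
    (hε : 0 < ε) (hw : ∀ l, 0 < w l) (hμ : ∀ l i, (μ l i).PosSemidef) (hν : ν ∈ psdFields d J)
    {t : ℝ} (ht : (t : EReal) < baryObjective c ρ ε w μ ν) :
    ∃ p ∈ dualVars d I J Λ, t < ρ * ∑ l, w l * ∑ i, (μ l i).trace + lagr c ρ ε w μ ν p := by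
  obtain ⟨r, hr, hr'⟩ := exists_real_lt_of_lt_sum _ ht
  choose q hq hq' using fun l => exists_lt_dualVal_of_lt_W hc hρ hε (hμ l) hν
    ((coe_lt_mul_iff (hw l)).1 (hr l (Finset.mem_univ l)))
  refine ⟨(fun l => (q l).1, fun l => (q l).2), ⟨fun l => (hq l).1, fun l => (hq l).2⟩, ?_⟩
  rw [sum_const_add_dualVal]
  refine hr'.trans_le (Finset.sum_le_sum fun l _ => ?_)
  have := hq' l
  rw [div_lt_iff₀ (hw l), mul_comm] at this
  exact this.le

theorem coe_add_iSup_le {ι : Type*} {S : Set ι} {f : ι → EReal} {C : ℝ} {x : EReal}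
    (h : ∀ p ∈ S, (C : EReal) + f p ≤ x) : (C : EReal) + ⨆ p ∈ S, f p ≤ x := by
  rw [add_comm, ← EReal.le_sub_iff_add_le (by simp) (by simp)]
  refine iSup₂_le fun p hp => ?_
  rw [EReal.le_sub_iff_add_le (by simp) (by simp), add_comm]
  exact h p hp

theorem baryObjective_eq (hc : ∀ i j, (c i j).IsSymm) (hρ : 0 < ρ)
    (hε : 0 < ε) (hw : ∀ l, 0 < w l) (hμ : ∀ l i, (μ l i).PosSemidef) (hν : ν ∈ psdFields d J) :
    baryObjective c ρ ε w μ ν = ((ρ * ∑ l, w l * ∑ i, (μ l i).trace : ℝ) : EReal) +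
      ⨆ p ∈ dualVars d I J Λ, (lagr c ρ ε w μ ν p : EReal) := by
  refine le_antisymm ?_ (coe_add_iSup_le fun p hp => lagr_le_baryObjective hc hρ hε hw hμ hp)
  by_contra hcon
  obtain ⟨t, h1, h2⟩ := EReal.lt_iff_exists_real_btwn.1 (not_le.1 hcon)
  obtain ⟨p, hp, hlt⟩ := exists_lt_lagr_of_lt_baryObjective hc hρ hε hw hμ hν h2
  refine absurd h1 (not_lt.2 ((EReal.coe_le_coe_iff.2 hlt.le).trans ?_))
  rw [EReal.coe_add]
  exact add_le_add le_rfl (le_iSup₂ (f := fun p _ => (lagr c ρ ε w μ ν p : EReal)) p hp)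

/-- The radius has to be fixed before the minimax theorem supplies a dual point, so the loss is
bounded in terms of B, ε and R alone; it tends to 0 with 1/R. -/
theorem exists_small_loss (B : ℝ) {ε δ : ℝ} (hδ : 0 < δ) :
    ∃ R, 0 < R ∧ B * (Real.exp (B / R / ε) - 1) < δ := by
  have hc : Continuous fun x : ℝ => B * (Real.exp (B * x / ε) - 1) := by fun_prop
  have h0 := hc.tendsto 0
  have h1 := h0.eventually_lt_const (u := δ) (by simpa using hδ)
  obtain ⟨x, hx, hx0⟩ := ((h1.filter_mono nhdsWithin_le_nhds).and
    (self_mem_nhdsWithin (s := Set.Ioi 0))).exists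
  have hx0' : (0 : ℝ) < x := hx0
  exact ⟨x⁻¹, inv_pos.2 hx0', by simpa [div_inv_eq_mul] using hx⟩

/-- Minimax on the ball tr ν ≤ R leaves an averaged potential that may pair positively with some ν.
Subtracting its support constant s from every v^ℓ makes the pairing nonpositive on the whole cone,
at the price of a factor e^{s/ε} on the kernel term. -/
theorem exists_le_innerMin (hc : ∀ i j, (c i j).IsSymm) (hρ : 0 < ρ) (hε : 0 < ε)
    (hw : ∀ l, 0 < w l) (hw1 : ∑ l, w l = 1) (hμ : ∀ l i, (μ l i).PosSemidef) {t t' : ℝ}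
    (htt' : t' < t) (h : ∀ ν ∈ psdFields d J, ∃ p ∈ dualVars d I J Λ, t < lagr c ρ ε w μ ν p) :
    ∃ p ∈ dualVars d I J Λ, (t' : EReal) ≤ innerMin c ρ ε w μ p := by
  obtain ⟨R, hR, hloss⟩ := exists_small_loss (-t) (ε := ε) (sub_pos.2 htt')
  obtain ⟨p, hp, hlt⟩ := exists_forall_lt_of_forall_exists_lt (X := boundedFields d J R)
    (Y := dualVars d I J Λ) (f := lagr c ρ ε w μ) (t := t)
    ⟨0, zero_mem_boundedFields hR.le⟩ (isCompact_boundedFields R) (convex_boundedFields R)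
    convex_dualVars (fun p _ => .of_contAff (convex_boundedFields R) contAff_lagr)
    (fun ν _ => convexLSC_neg_lagr hc hρ hε hw hμ) (fun ν hν => h ν hν.1)
  obtain ⟨s, hs, hle, hatt⟩ := exists_support (avgPot w p.2)
  obtain ⟨η, hη, hηs⟩ := hatt R hR.le
  -- At the field η of the ball that maximizes the pairing, t < -(entropic part + kernel part) - R
  -- s. All terms being nonnegative, this bounds the kernel part by -t and s by -t/R.
  have h1 := hlt η hη
  rw [lagr_eq, hηs] at h1
  have hU := entPart_nonneg (μ := μ) hρ hw hp
  have hE := kernPart_nonneg (ρ := ρ) hc hε hw hp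
  have hRs := mul_nonneg hR.le hs
  have hsR : s ≤ -t / R := by
    rw [le_div_iff₀ hR]; linarith
  set q : (Λ → I → Mat d) × (Λ → J → Mat d) :=
    (p.1, fun l j => p.2 l j + (ε * (-(s / ε))) • (1 : Mat d)) with hq
  have hq' : q ∈ dualVars d I J Λ :=
    ⟨hp.1, fun l j => (hp.2 l j).add (Matrix.isSymm_one.smul _)⟩
  have e1 : kernPart c ρ ε w q = Real.exp (s / ε) * kernPart c ρ ε w p := by
    have : ∀ l i j, mexp (kern c ρ ε (q.1 l) (q.2 l) i j) =
        Real.exp (s / ε) • mexp (kern c ρ ε (p.1 l) (p.2 l) i j) := fun l i j => by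
      have h := kern_shift (c := c) (ρ := ρ) hε (p.1 l) (p.2 l) (fun _ => -(s / ε)) i j
      rw [hq, h, mexp_sub_smul_one (isSymm_kern hc (hp.1 l) (hp.2 l) i j), neg_neg]
    simp only [kernPart, this, Matrix.trace_smul, smul_eq_mul, ← Finset.mul_sum]
    rw [Finset.mul_sum]
    exact Finset.sum_congr rfl fun l _ => by ring
  have e2 : ∀ j, avgPot w q.2 j = avgPot w p.2 j - s • (1 : Mat d) := fun j => by
    simp only [avgPot, hq, smul_add, Finset.sum_add_distrib, ← Finset.sum_smul, hw1, one_smul]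
    rw [mul_neg, mul_div_cancel₀ _ hε.ne', neg_smul, sub_eq_add_neg]
  refine ⟨q, hq', le_iInf₂ fun ν hν => EReal.coe_le_coe_iff.2 ?_⟩
  have h2 := hle ν hν
  rw [lagr_eq, e1]
  simp only [e2, Matrix.mul_sub, Matrix.mul_smul, Matrix.mul_one, Matrix.trace_sub,
    Matrix.trace_smul, smul_eq_mul, Finset.sum_sub_distrib, ← Finset.mul_sum]
  have hexp1 : 0 ≤ Real.exp (s / ε) - 1 := by
    linarith [Real.add_one_le_exp (s / ε), div_nonneg hs hε.le]
  have h3 : kernPart c ρ ε w p * (Real.exp (s / ε) - 1) ≤ -t * (Real.exp (-t / R / ε) - 1) := by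
    refine mul_le_mul (by linarith) ?_ hexp1 (by linarith)
    gcongr
  have : (q.1) = p.1 := rfl
  rw [this]
  nlinarith

theorem iInf_baryObjective_eq (hc : ∀ i j, (c i j).IsSymm) (hρ : 0 < ρ) (hε : 0 < ε)
    (hw : ∀ l, 0 < w l) (hw1 : ∑ l, w l = 1) (hμ : ∀ l i, (μ l i).PosSemidef) :
    (⨅ ν ∈ psdFields d J, baryObjective c ρ ε w μ ν) =
      ((ρ * ∑ l, w l * ∑ i, (μ l i).trace : ℝ) : EReal) +
        ⨆ p ∈ dualVars d I J Λ, innerMin c ρ ε w μ p := by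
  set C := ρ * ∑ l, w l * ∑ i, (μ l i).trace with hC
  refine le_antisymm ?_ (coe_add_iSup_le fun p hp => le_iInf₂ fun ν hν => ?_)
  · by_contra hcon
    obtain ⟨t', h1, h2⟩ := EReal.lt_iff_exists_real_btwn.1 (not_le.1 hcon)
    obtain ⟨t, h3, h4⟩ := EReal.lt_iff_exists_real_btwn.1 h2
    obtain ⟨p, hp, hle⟩ := exists_le_innerMin (c := c) (μ := μ) (t := t - C) (t' := t' - C) hc hρ
      hε hw hw1 hμ (by linarith [EReal.coe_lt_coe_iff.1 h3]) fun ν hν => by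
        obtain ⟨p, hp, hlt⟩ := exists_lt_lagr_of_lt_baryObjective hc hρ hε hw hμ hν
          (h4.trans_le (iInf₂_le ν hν))
        exact ⟨p, hp, by linarith⟩
    refine absurd h1 (not_lt.2 ?_)
    calc (t' : EReal) = (C : EReal) + ((t' - C : ℝ) : EReal) := by
          rw [← EReal.coe_add, add_sub_cancel]
      _ ≤ _ := add_le_add le_rfl (hle.trans (le_iSup₂ (f := fun p _ => innerMin c ρ ε w μ p) p hp))
  · exact (add_le_add le_rfl (iInf₂_le ν hν)).trans (lagr_le_baryObjective hc hρ hε hw hμ hp)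

end

section

variable {d : ℕ} {I J Λ : Type*}

/-! ### Uniform bounds on dual variables -/

theorem exists_uniform_bound {X ι : Type*} [Fintype ι] {S : Set X} {g : ι → X → ℝ}
    (h : ∀ i, ∃ M, ∀ p ∈ S, g i p ≤ M) : ∃ M, ∀ p ∈ S, ∀ i, g i p ≤ M := by
  choose M hM using h
  refine ⟨∑ i, |M i|, fun p hp i => (hM i p hp).trans ((le_abs_self _).trans ?_)⟩
  exact Finset.single_le_sum (f := fun i => |M i|) (fun i _ => abs_nonneg _) (Finset.mem_univ i)

theorem trace_vecMulVec_mul (x : Fin d → ℝ) (X : Mat d) :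
    (Matrix.vecMulVec x x * X).trace = x ⬝ᵥ (X *ᵥ x) := by
  rw [Matrix.trace_mul_comm, Matrix.mul_vecMulVec, Matrix.trace_vecMulVec, dotProduct_comm]

/-- Rank-one test matrices bound the quadratic forms of f, and polarization at e_a, e_b and e_a +
e_b recovers the entries. -/
theorem exists_entry_bound {X : Type*} {S : Set X} {f : X → Mat d}
    (hs : ∀ p ∈ S, (f p).IsSymm)
    (hub : ∀ A : Mat d, A.PosSemidef → ∃ M, ∀ p ∈ S, (A * f p).trace ≤ M)
    (hlb : ∀ A : Mat d, A.PosSemidef → ∃ M, ∀ p ∈ S, -(A * f p).trace ≤ M) :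
    ∃ M, ∀ p ∈ S, ∀ a b, |f p a b| ≤ M := by
  have hpsd : ∀ x : Fin d → ℝ, (Matrix.vecMulVec x x).PosSemidef := fun x => by
    simpa using Matrix.posSemidef_vecMulVec_self_star x
  have hq : ∀ x : Fin d → ℝ, ∃ M, ∀ p ∈ S, |x ⬝ᵥ (f p *ᵥ x)| ≤ M := fun x => by
    obtain ⟨M1, h1⟩ := hub _ (hpsd x)
    obtain ⟨M2, h2⟩ := hlb _ (hpsd x)
    refine ⟨max M1 M2, fun p hp => ?_⟩
    have k1 := h1 p hp
    have k2 := h2 p hp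
    rw [trace_vecMulVec_mul] at k1 k2
    exact max_le_max k1 k2
  have key : ∀ ab : Fin d × Fin d, ∃ M, ∀ p ∈ S, |f p ab.1 ab.2| ≤ M := by
    rintro ⟨a, b⟩
    obtain ⟨M1, h1⟩ := hq (Pi.single a 1)
    obtain ⟨M2, h2⟩ := hq (Pi.single b 1)
    obtain ⟨M3, h3⟩ := hq (Pi.single a 1 + Pi.single b 1)
    refine ⟨M1 + M2 + M3, fun p hp => ?_⟩
    have k1 := h1 p hp
    have k2 := h2 p hp
    have k3 := h3 p hp
    have hsym : f p b a = f p a b := (hs p hp).apply a b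
    rw [Matrix.mulVec_add, add_dotProduct, dotProduct_add, dotProduct_add] at k3
    simp only [Matrix.mulVec_single, single_dotProduct, Pi.smul_apply, Matrix.col_apply,
      MulOpposite.smul_eq_mul_unop, MulOpposite.unop_op, one_mul, mul_one, hsym] at k1 k2 k3
    rw [abs_le] at k1 k2 k3 ⊢
    constructor <;> linarith
  obtain ⟨M, hM⟩ := exists_uniform_bound key
  exact ⟨M, fun p hp a b => hM p hp (a, b)⟩

variable [Fintype I] [Fintype J] [Fintype Λ]
variable {c : I → J → Mat d} {ρ ε : ℝ} {w : Λ → ℝ} {μ : Λ → I → Mat d} {ν : J → Mat d}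
  {p : (Λ → I → Mat d) × (Λ → J → Mat d)}

/-- Superlevel sets of the dual objective of the barycenter problem. -/
def dualSuperlevel (c : I → J → Mat d) (ρ ε : ℝ) (w : Λ → ℝ) (μ : Λ → I → Mat d) (B : ℝ) :
    Set ((Λ → I → Mat d) × (Λ → J → Mat d)) :=
  {p | p ∈ dualVars d I J Λ ∧ ∀ ν ∈ psdFields d J, -B ≤ lagr c ρ ε w μ ν p}

theorem lagr_zero_left : lagr c ρ ε w μ 0 p = -(entPart ρ w μ p.1 + kernPart c ρ ε w p) := by
  simp [lagr_eq]

section superlevel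
variable {B : ℝ}

theorem entPart_add_kernPart_le (hp : p ∈ dualSuperlevel c ρ ε w μ B) :
    entPart ρ w μ p.1 + kernPart c ρ ε w p ≤ B := by
  have := hp.2 0 zero_mem_psdFields
  rw [lagr_zero_left] at this
  linarith

theorem trace_expAddLog_le (hc : ∀ i j, (c i j).IsSymm) (hρ : 0 < ρ) (hε : 0 < ε)
    (hw : ∀ l, 0 < w l) (hp : p ∈ dualSuperlevel c ρ ε w μ B) (l : Λ) (i : I) :
    (expAddLog (p.1 l i) (μ l i)).trace ≤ B / (w l * ρ) := by
  have h0 := entPart_add_kernPart_le hp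
  have h1 := kernPart_nonneg (ρ := ρ) hc hε hw hp.1
  have hnn : ∀ l i, 0 ≤ (expAddLog (p.1 l i) (μ l i)).trace := fun l i =>
    (psd_expAddLog (hp.1.1 l i) _).trace_nonneg
  rw [le_div_iff₀ (mul_pos (hw l) hρ), mul_comm, mul_assoc]
  have h2 : (expAddLog (p.1 l i) (μ l i)).trace ≤ ∑ i, (expAddLog (p.1 l i) (μ l i)).trace :=
    Finset.single_le_sum (f := fun i => (expAddLog (p.1 l i) (μ l i)).trace)
      (fun i _ => hnn l i) (Finset.mem_univ i)
  have h3 : w l * (ρ * ∑ i, (expAddLog (p.1 l i) (μ l i)).trace) ≤ entPart ρ w μ p.1 :=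
    Finset.single_le_sum (f := fun l => w l * (ρ * ∑ i, (expAddLog (p.1 l i) (μ l i)).trace))
      (fun l _ => mul_nonneg (hw l).le (mul_nonneg hρ.le (Finset.sum_nonneg fun i _ => hnn l i)))
      (Finset.mem_univ l)
  have h4 := mul_le_mul_of_nonneg_left (mul_le_mul_of_nonneg_left h2 hρ.le) (hw l).le
  linarith

theorem trace_mexp_kern_le (hc : ∀ i j, (c i j).IsSymm) (hρ : 0 < ρ) (hε : 0 < ε)
    (hw : ∀ l, 0 < w l) (hp : p ∈ dualSuperlevel c ρ ε w μ B) (l : Λ) (i : I) (j : J) :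
    (mexp (kern c ρ ε (p.1 l) (p.2 l) i j)).trace ≤ B / (w l * ε) := by
  have h0 := entPart_add_kernPart_le hp
  have h1 := entPart_nonneg (μ := μ) hρ hw hp.1
  have hnn : ∀ l i j, 0 ≤ (mexp (kern c ρ ε (p.1 l) (p.2 l) i j)).trace :=
    trace_mexp_kern_nonneg hc hp.1
  rw [le_div_iff₀ (mul_pos (hw l) hε), mul_comm, mul_assoc]
  have h2 : (mexp (kern c ρ ε (p.1 l) (p.2 l) i j)).trace ≤
      ∑ i, ∑ j, (mexp (kern c ρ ε (p.1 l) (p.2 l) i j)).trace :=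
    (Finset.single_le_sum (f := fun j => (mexp (kern c ρ ε (p.1 l) (p.2 l) i j)).trace)
      (fun j _ => hnn l i j) (Finset.mem_univ j)).trans
    (Finset.single_le_sum (f := fun i => ∑ j, (mexp (kern c ρ ε (p.1 l) (p.2 l) i j)).trace)
      (fun i _ => Finset.sum_nonneg fun j _ => hnn l i j) (Finset.mem_univ i))
  have h3 : w l * (ε * ∑ i, ∑ j, (mexp (kern c ρ ε (p.1 l) (p.2 l) i j)).trace) ≤
      kernPart c ρ ε w p :=
    Finset.single_le_sum
      (f := fun l => w l * (ε * ∑ i, ∑ j, (mexp (kern c ρ ε (p.1 l) (p.2 l) i j)).trace))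
      (fun l _ => mul_nonneg (hw l).le (mul_nonneg hε.le
        (Finset.sum_nonneg fun i _ => Finset.sum_nonneg fun j _ => hnn l i j)))
      (Finset.mem_univ l)
  have h4 := mul_le_mul_of_nonneg_left (mul_le_mul_of_nonneg_left h2 hε.le) (hw l).le
  linarith

/-- Otherwise the Lagrangian would tend to -∞ along the ray spanned by A placed at j. The multiple
(B + 1)/a already takes it below -B. -/
theorem trace_mul_avgPot_nonpos (hc : ∀ i j, (c i j).IsSymm) (hρ : 0 < ρ) (hε : 0 < ε)
    (hw : ∀ l, 0 < w l) (hp : p ∈ dualSuperlevel c ρ ε w μ B) {A : Mat d} (hA : A.PosSemidef)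
    (j : J) : (A * avgPot w p.2 j).trace ≤ 0 := by
  classical
  by_contra! hpos
  have h1 := entPart_nonneg (μ := μ) hρ hw hp.1
  have h2 := kernPart_nonneg (ρ := ρ) hc hε hw hp.1
  have h3 := entPart_add_kernPart_le hp
  set a := (A * avgPot w p.2 j).trace
  have hs : 0 ≤ (B + 1) / a := div_nonneg (by linarith) hpos.le
  have h4 := hp.2 (Pi.single j (((B + 1) / a) • A)) fun j' => by
    rcases eq_or_ne j' j with rfl | hne
    · rw [Pi.single_eq_same]; exact hA.smul hs
    · rw [Pi.single_eq_of_ne hne]; exact Matrix.PosSemidef.zero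
  rw [lagr_eq, Finset.sum_eq_single j (fun j' _ hne => by
    rw [Pi.single_eq_of_ne hne, Matrix.zero_mul, Matrix.trace_zero]) (by simp),
    Pi.single_eq_same, Matrix.smul_mul, Matrix.trace_smul, smul_eq_mul,
    div_mul_cancel₀ _ hpos.ne'] at h4
  linarith

/-- The bounds follow a cycle. The Gibbs inequality for μ bounds u above; the one for the kernel
bounds ρu + v below, hence v below. The average of the v^ℓ is nonpositive, so each v^ℓ is bounded
above by means of the others; the kernel bound then bounds u below. Positive definiteness of μ makes
KL(A|μ) finite for every positive semidefinite test matrix A. -/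
theorem exists_bound_dualSuperlevel [Nonempty I] [Nonempty J] (hc : ∀ i j, (c i j).IsSymm)
    (hρ : 0 < ρ) (hε : 0 < ε) (hw : ∀ l, 0 < w l) (hμ : ∀ l i, (μ l i).PosDef) (B : ℝ) :
    ∃ M, 0 ≤ M ∧ ∀ p ∈ dualSuperlevel c ρ ε w μ B,
      (∀ l i a b, |p.1 l i a b| ≤ M) ∧ ∀ l j a b, |p.2 l j a b| ≤ M := by
  classical
  have hkern : ∀ A : Mat d, A.PosSemidef → ∀ l i j, ∃ M, ∀ p ∈ dualSuperlevel c ρ ε w μ B,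
      -(ρ * (A * p.1 l i).trace) - (A * p.2 l j).trace ≤ M := fun A hA l i j => by
    refine ⟨ε * (negEnt A + B / (w l * ε)) + (A * c i j).trace, fun p hp => ?_⟩
    have h1 := le_negEnt hA (isSymm_kern (ρ := ρ) (ε := ε) hc (hp.1.1 l) (hp.1.2 l) i j)
    have h2 := trace_mexp_kern_le hc hρ hε hw hp l i j
    have h3 := trace_mul_kern (c := c) (ρ := ρ) hε A (p.1 l) (p.2 l) i j
    have h4 := mul_le_mul_of_nonneg_left
      (show (A * kern c ρ ε (p.1 l) (p.2 l) i j).trace ≤ negEnt A + B / (w l * ε) by linarith)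
      hε.le
    rw [h3, Matrix.mul_add, Matrix.mul_add, Matrix.mul_smul, Matrix.trace_add, Matrix.trace_add,
      Matrix.trace_smul, smul_eq_mul] at h4
    linarith
  have hu1 : ∀ l i, ∀ A : Mat d, A.PosSemidef → ∃ M, ∀ p ∈ dualSuperlevel c ρ ε w μ B,
      (A * p.1 l i).trace ≤ M := fun l i A hA => by
    refine ⟨relEnt A (μ l i) + B / (w l * ρ) - (μ l i).trace, fun p hp => ?_⟩
    have hker : KerLE (μ l i) A := fun x hx => by
      have : x = 0 := by
        by_contra hx0
        have := (hμ l i).dotProduct_mulVec_pos hx0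
        rw [hx, dotProduct_zero] at this
        exact lt_irrefl _ this
      rw [this, Matrix.mulVec_zero]
    have h1 := le_relEnt hA (psd_isSymm (hμ l i).posSemidef) (hp.1.1 l i) hker
    have h2 := trace_expAddLog_le hc hρ hε hw hp l i
    linarith
  have hv2 : ∀ l j, ∀ A : Mat d, A.PosSemidef → ∃ M, ∀ p ∈ dualSuperlevel c ρ ε w μ B,
      -(A * p.2 l j).trace ≤ M := fun l j A hA => by
    obtain ⟨i⟩ := ‹Nonempty I›
    obtain ⟨M1, h1⟩ := hkern A hA l i j
    obtain ⟨M2, h2⟩ := hu1 l i A hA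
    refine ⟨M1 + ρ * M2, fun p hp => ?_⟩
    have := mul_le_mul_of_nonneg_left (h2 p hp) hρ.le
    linarith [h1 p hp]
  have hv1 : ∀ l j, ∀ A : Mat d, A.PosSemidef → ∃ M, ∀ p ∈ dualSuperlevel c ρ ε w μ B,
      (A * p.2 l j).trace ≤ M := fun l j A hA => by
    choose M hM using fun l => hv2 l j A hA
    refine ⟨(∑ l' ∈ Finset.univ.erase l, w l' * M l') / w l, fun p hp => ?_⟩
    have h1 := trace_mul_avgPot_nonpos hc hρ hε hw hp hA j
    simp only [avgPot, Finset.mul_sum, Matrix.mul_smul, Matrix.trace_sum,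
      Matrix.trace_smul, smul_eq_mul] at h1
    rw [← Finset.add_sum_erase _ _ (Finset.mem_univ l)] at h1
    have h2 : ∑ l' ∈ Finset.univ.erase l, -(w l' * (A * p.2 l' j).trace) ≤
        ∑ l' ∈ Finset.univ.erase l, w l' * M l' := Finset.sum_le_sum fun l' _ => by
      rw [← mul_neg]
      exact mul_le_mul_of_nonneg_left (hM l' p hp) (hw l').le
    rw [Finset.sum_neg_distrib] at h2
    rw [le_div_iff₀ (hw l), mul_comm]
    linarith
  have hu2 : ∀ l i, ∀ A : Mat d, A.PosSemidef → ∃ M, ∀ p ∈ dualSuperlevel c ρ ε w μ B,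
      -(A * p.1 l i).trace ≤ M := fun l i A hA => by
    obtain ⟨j⟩ := ‹Nonempty J›
    obtain ⟨M1, h1⟩ := hkern A hA l i j
    obtain ⟨M2, h2⟩ := hv1 l j A hA
    refine ⟨(M1 + M2) / ρ, fun p hp => ?_⟩
    rw [le_div_iff₀ hρ]
    linarith [h1 p hp, h2 p hp]
  have bu := fun (li : Λ × I) => exists_entry_bound (S := dualSuperlevel c ρ ε w μ B)
    (f := fun p => p.1 li.1 li.2) (fun p hp => hp.1.1 li.1 li.2) (hu1 li.1 li.2) (hu2 li.1 li.2)
  have bv := fun (lj : Λ × J) => exists_entry_bound (S := dualSuperlevel c ρ ε w μ B)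
    (f := fun p => p.2 lj.1 lj.2) (fun p hp => hp.1.2 lj.1 lj.2) (hv1 lj.1 lj.2) (hv2 lj.1 lj.2)
  choose Mu hMu using bu
  choose Mv hMv using bv
  refine ⟨∑ li, |Mu li| + ∑ lj, |Mv lj|, by positivity, fun p hp => ⟨fun l i a b => ?_,
    fun l j a b => ?_⟩⟩
  · have h1 : |Mu (l, i)| ≤ ∑ li, |Mu li| := Finset.single_le_sum (f := fun li => |Mu li|) (fun i _ => abs_nonneg _)
      (Finset.mem_univ (l, i))
    have h2 : 0 ≤ ∑ lj, |Mv lj| := by positivity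
    have h3 : |p.1 l i a b| ≤ Mu (l, i) := hMu (l, i) p hp a b
    have h4 := le_abs_self (Mu (l, i))
    linarith
  · have h1 : |Mv (l, j)| ≤ ∑ lj, |Mv lj| := Finset.single_le_sum (f := fun lj => |Mv lj|) (fun i _ => abs_nonneg _)
      (Finset.mem_univ (l, j))
    have h2 : 0 ≤ ∑ li, |Mu li| := by positivity
    have h3 : |p.2 l j a b| ≤ Mv (l, j) := hMv (l, j) p hp a b
    have h4 := le_abs_self (Mv (l, j))
    linarith

end superlevel

theorem upperSemicontinuousOn_innerMin (hc : ∀ i j, (c i j).IsSymm) (hρ : 0 < ρ) (hε : 0 < ε)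
    (hw : ∀ l, 0 < w l) (hμ : ∀ l i, (μ l i).PosSemidef) :
    UpperSemicontinuousOn (innerMin c ρ ε w μ) (dualVars d I J Λ) := by
  unfold innerMin
  refine upperSemicontinuousOn_biInf fun ν _ => ?_
  have h1 : UpperSemicontinuousOn (lagr c ρ ε w μ ν) (dualVars d I J Λ) := by
    intro p hp t ht
    have := (convexLSC_neg_lagr (ν := ν) hc hρ hε hw hμ).lsc p hp (-t) (by simpa using ht)
    filter_upwards [this] with q hq
    simpa using hq
  exact continuous_coe_real_ereal.comp_upperSemicontinuousOn h1 EReal.coe_strictMono.monotone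

theorem exists_isMaxOn_innerMin [Nonempty I] [Nonempty J] (hc : ∀ i j, (c i j).IsSymm)
    (hρ : 0 < ρ) (hε : 0 < ε) (hw : ∀ l, 0 < w l) (hμ : ∀ l i, (μ l i).PosDef) :
    ∃ p ∈ dualVars d I J Λ, IsMaxOn (innerMin c ρ ε w μ) (dualVars d I J Λ) p := by
  -- The dual objective at zero potentials is -B, so any point outside this superlevel set is beaten
  -- by 0, which lies in K.
  set B := entPart ρ w μ (0 : Λ → I → Mat d) +
    kernPart c ρ ε w (0 : (Λ → I → Mat d) × (Λ → J → Mat d)) with hB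
  obtain ⟨M, hM0, hM⟩ := exists_bound_dualSuperlevel hc hρ hε hw hμ B
  set K : Set ((Λ → I → Mat d) × (Λ → J → Mat d)) := dualVars d I J Λ ∩
    ((Set.univ.pi fun _ => Set.univ.pi fun _ => {X : Mat d | ∀ a b, |X a b| ≤ M}) ×ˢ
      (Set.univ.pi fun _ => Set.univ.pi fun _ => {X : Mat d | ∀ a b, |X a b| ≤ M})) with hK
  have cK : IsCompact K := IsCompact.inter_left (IsCompact.prod
    (isCompact_univ_pi fun _ => isCompact_univ_pi fun _ => isCompact_entries_le M)
    (isCompact_univ_pi fun _ => isCompact_univ_pi fun _ => isCompact_entries_le M))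
    isClosed_dualVars
  have h0 : (0 : (Λ → I → Mat d) × (Λ → J → Mat d)) ∈ K :=
    ⟨zero_mem_dualVars, fun _ _ _ _ _ _ => by simpa using hM0,
      fun _ _ _ _ _ _ => by simpa using hM0⟩
  obtain ⟨q, hq, hmax⟩ := UpperSemicontinuousOn.exists_isMaxOn ⟨0, h0⟩ cK
    ((upperSemicontinuousOn_innerMin hc hρ hε hw fun l i => (hμ l i).posSemidef).mono
      (fun p hp => hp.1))
  refine ⟨q, hq.1, fun p hp => ?_⟩
  by_cases h : ((-B : ℝ) : EReal) ≤ innerMin c ρ ε w μ p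
  · have hp' : p ∈ dualSuperlevel c ρ ε w μ B :=
      ⟨hp, fun ν hν => EReal.coe_le_coe_iff.1 (h.trans (iInf₂_le ν hν))⟩
    exact hmax ⟨hp, fun l _ i _ => (hM p hp').1 l i, fun l _ j _ => (hM p hp').2 l j⟩
  · refine ((not_le.1 h).le.trans ?_).trans (hmax h0)
    refine le_iInf₂ fun ν _ => EReal.coe_le_coe_iff.2 ?_
    simp [lagr_eq, avgPot, hB]

/-! ### Existence and uniqueness of the barycenter -/

theorem iSup_lagr_zero_le (hc : ∀ i j, (c i j).IsSymm) (hρ : 0 < ρ) (hε : 0 < ε)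
    (hw : ∀ l, 0 < w l) :
    ⨆ p ∈ dualVars d I J Λ, (lagr c ρ ε w μ 0 p : EReal) ≤ 0 :=
  iSup₂_le fun p hp => by
    rw [lagr_zero_left]
    have h1 := entPart_nonneg (μ := μ) hρ hw hp
    have h2 := kernPart_nonneg (ρ := ρ) hc hε hw hp
    exact_mod_cast (by linarith : -(entPart ρ w μ p.1 + kernPart c ρ ε w p) ≤ 0)

theorem isBarycenter_iff : IsBarycenter c ρ ε w μ ν ↔ ν ∈ psdFields d J ∧
    baryObjective c ρ ε w μ ν = ⨅ ν ∈ psdFields d J, baryObjective c ρ ε w μ ν := by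
  refine and_congr_right fun hν => ⟨fun h => le_antisymm (le_iInf₂ fun η hη => h hη)
    (iInf₂_le ν hν), fun h η hη => ?_⟩
  rw [Set.mem_ofPred_eq, h]
  exact iInf₂_le η hη

theorem exists_isBarycenter (hc : ∀ i j, (c i j).IsSymm) (hρ : 0 < ρ) (hε : 0 < ε)
    (hw : ∀ l, 0 < w l) (hw1 : ∑ l, w l = 1) (hμ : ∀ l i, (μ l i).PosSemidef) :
    ∃ ν, IsBarycenter c ρ ε w μ ν := by
  set S : (J → Mat d) → EReal := fun ν => ⨆ p ∈ dualVars d I J Λ, (lagr c ρ ε w μ ν p : EReal)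
    with hS
  have lsc : LowerSemicontinuous S := lowerSemicontinuous_biSup fun p _ =>
    (continuous_coe_real_ereal.comp contAff_lagr.cont).lowerSemicontinuous
  -- At these potentials the Lagrangian is tr ν - R. Beyond total trace R the supremum is therefore
  -- nonnegative, while it is at most 0 at ν = 0: minimizing on the ball suffices.
  set p0 : (Λ → I → Mat d) × (Λ → J → Mat d) := (0, fun _ _ => -1) with hp0
  have hp0' : p0 ∈ dualVars d I J Λ :=
    ⟨fun _ _ => Matrix.isSymm_zero, fun _ _ => Matrix.isSymm_one.neg⟩
  set R := entPart ρ w μ p0.1 + kernPart c ρ ε w p0 with hR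
  have hR0 : 0 ≤ R := add_nonneg (entPart_nonneg hρ hw hp0') (kernPart_nonneg hc hε hw hp0')
  have hL : ∀ ν : J → Mat d, lagr c ρ ε w μ ν p0 = ∑ j, (ν j).trace - R := fun ν => by
    have : ∀ j : J, avgPot w p0.2 j = (-1 : Mat d) := fun j => by
      simp only [avgPot, hp0, ← Finset.sum_smul, hw1, one_smul]
    rw [lagr_eq]
    simp only [this, Matrix.mul_neg, Matrix.mul_one, Matrix.trace_neg, Finset.sum_neg_distrib]
    ring
  obtain ⟨ν, hν, hmin⟩ := LowerSemicontinuousOn.exists_isMinOn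
    ⟨0, zero_mem_boundedFields (d := d) (J := J) hR0⟩ (isCompact_boundedFields R)
    (lsc.lowerSemicontinuousOn _)
  refine ⟨ν, hν.1, fun η hη => ?_⟩
  rw [Set.mem_ofPred_eq, baryObjective_eq hc hρ hε hw hμ hν.1, baryObjective_eq hc hρ hε hw hμ hη]
  refine add_le_add le_rfl ?_
  by_cases h : η ∈ boundedFields d J R
  · exact hmin h
  · have h1 : R < ∑ j, (η j).trace := not_le.1 fun h' => h ⟨hη, h'⟩
    calc S ν ≤ S 0 := hmin (zero_mem_boundedFields hR0)
      _ ≤ 0 := iSup_lagr_zero_le hc hρ hε hw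
      _ ≤ (lagr c ρ ε w μ η p0 : EReal) := by
        rw [hL]; exact_mod_cast (by linarith : (0 : ℝ) ≤ ∑ j, (η j).trace - R)
      _ ≤ S η := le_iSup₂ (f := fun p _ => (lagr c ρ ε w μ η p : EReal)) p0 hp0'

end

section

variable {d : ℕ} {I J Λ : Type*} [Fintype I]

/-! ### Optimal couplings and strict convexity of W -/

theorem couplings_nonempty [Nonempty I] {ν : J → Mat d} (hν : ν ∈ psdFields d J) :
    (couplings I ν).Nonempty := by
  classical
  obtain ⟨i0⟩ := ‹Nonempty I›
  refine ⟨fun i j => if i = i0 then ν j else 0, fun i j => ?_, fun j => by simp⟩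
  dsimp only
  split_ifs
  · exact hν j
  · exact Matrix.PosSemidef.zero

variable [Fintype J] [Fintype Λ]
variable {c : I → J → Mat d} {ρ ε : ℝ} {w : Λ → ℝ} {ν : J → Mat d}

section
variable {μ : I → Mat d} {γ γ' : I → J → Mat d}

/-- The finite values of the energy. -/
def realEnergy (c : I → J → Mat d) (ρ ε : ℝ) (μ : I → Mat d) (γ : I → J → Mat d) : ℝ :=
  ∑ i, ∑ j, (γ i j * c i j).trace + ρ * ∑ i, relEnt (∑ j, γ i j) (μ i)
    + ε * ∑ i, ∑ j, negEnt (γ i j)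

theorem energy_eq_realEnergy (hc : ∀ i j, (c i j).IsSymm) (hγ : ∀ i j, (γ i j).PosSemidef)
    (h : ∀ i, KerLE (μ i) (∑ j, γ i j)) :
    energy c ρ ε μ γ = (realEnergy c ρ ε μ γ : EReal) := by
  have : ∀ i, KL (∑ j, γ i j) (μ i) = (relEnt (∑ j, γ i j) (μ i) : EReal) := fun i =>
    KL_eq_of_kerLE (Matrix.posSemidef_sum _ fun j _ => hγ i j) (h i)
  simp only [energy_eq hc, this, realEnergy, EReal.coe_add, EReal.coe_mul, coe_finset_sum]

/-- The value ⊥ must be excluded because ⊤ + ⊥ = ⊥ in `EReal`. -/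
theorem ne_top_of_sum_le {ι : Type*} (S : Finset ι) {x : ι → EReal} (hbot : ∀ i, x i ≠ ⊥)
    (h : ∑ i ∈ S, x i ≠ ⊤) : ∀ i ∈ S, x i ≠ ⊤ := by
  classical
  intro i hi htop
  have hb : ∀ T : Finset ι, ∑ i ∈ T, x i ≠ ⊥ := fun T => by
    induction T using Finset.induction_on with
    | empty => simp
    | insert a T ha ih =>
      rw [Finset.sum_insert ha]
      exact (EReal.bot_lt_add_iff.2 ⟨bot_lt_iff_ne_bot.2 (hbot a), bot_lt_iff_ne_bot.2 ih⟩).ne'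
  rw [← Finset.add_sum_erase S x hi, htop, EReal.top_add_of_ne_bot (hb _)] at h
  exact h rfl

theorem kerLE_of_energy_ne_top (hc : ∀ i j, (c i j).IsSymm) (hρ : 0 < ρ)
    (hμ : ∀ i, (μ i).PosSemidef) (hγ : ∀ i j, (γ i j).PosSemidef)
    (h : energy c ρ ε μ γ ≠ ⊤) (i : I) : KerLE (μ i) (∑ j, γ i j) := by
  have hsum : ∑ i, KL (∑ j, γ i j) (μ i) ≠ ⊤ := fun htop => by
    rw [energy_eq hc, htop, EReal.coe_mul_top_of_pos hρ, EReal.coe_add_top, EReal.top_add_coe] at h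
    exact h rfl
  have hi := ne_top_of_sum_le Finset.univ (fun i => ne_of_gt <| (EReal.bot_lt_coe _).trans_le
    (le_KL (u := 0) (Matrix.posSemidef_sum _ fun j _ => hγ i j) (psd_isSymm (hμ i))
      Matrix.isSymm_zero)) hsum i (Finset.mem_univ i)
  by_contra hker
  exact hi (KL_eq_top_of_not_kerLE hker)

/-- A potential u that is nearly optimal at γ gives a Lagrangian that is lower semicontinuous in the
coupling and minorizes the energy on all couplings of ν. -/
theorem lowerSemicontinuousOn_energy (hc : ∀ i j, (c i j).IsSymm) (hρ : 0 < ρ) (hε : 0 < ε)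
    (hμ : ∀ i, (μ i).PosSemidef) :
    LowerSemicontinuousOn (energy c ρ ε μ) (couplings I ν) := by
  intro γ hγ t ht
  obtain ⟨s, hts, hs⟩ := EReal.lt_iff_exists_real_btwn.1 ht
  obtain ⟨u, hu, hu'⟩ := exists_lt_transportLagr_of_lt_energy hc hρ hμ hγ hs
  have h1 := ((convexLSC_transportLagr (c := c) (ρ := ρ) (μ := μ) (ν := ν) (p := (u, 0))
    hε).lsc.mono (fun γ (hγ : γ ∈ couplings I ν) => hγ.1)) γ hγ s (hu' 0)
  filter_upwards [h1, self_mem_nhdsWithin] with η hη hη'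
  exact hts.trans ((EReal.coe_lt_coe_iff.2 hη).trans_le
    (transportLagr_le_energy hc hρ hμ ⟨hu, fun _ => Matrix.isSymm_zero⟩ hη'))

theorem isCompact_couplings (hν : ν ∈ psdFields d J) : IsCompact (couplings I ν) := by
  have e : {γ : I → J → Mat d | ∀ j, ∑ i, γ i j = ν j} = ⋂ j, {γ | ∑ i, γ i j = ν j} := by
    ext γ; simp
  have hcl : IsClosed {γ : I → J → Mat d | ∀ j, ∑ i, γ i j = ν j} := by
    rw [e]
    exact isClosed_iInter fun j => isClosed_eq (by fun_prop) continuous_const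
  refine isCompact_of_plans (isClosed_psdPlans.inter hcl) (∑ j, (ν j).trace) fun γ hγ i j =>
    ⟨hγ.1 i j, ?_⟩
  calc (γ i j).trace ≤ ∑ i, (γ i j).trace := trace_le_sum_trace (fun i => hγ.1 i j) i
    _ = (ν j).trace := by rw [← Matrix.trace_sum, hγ.2 j]
    _ ≤ ∑ j, (ν j).trace := trace_le_sum_trace hν j

theorem exists_W_eq_energy [Nonempty I] (hc : ∀ i j, (c i j).IsSymm) (hρ : 0 < ρ) (hε : 0 < ε)
    (hμ : ∀ i, (μ i).PosSemidef) (hν : ν ∈ psdFields d J) :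
    ∃ γ ∈ couplings I ν, W c ρ ε μ ν = energy c ρ ε μ γ := by
  obtain ⟨γ, hγ, hmin⟩ := LowerSemicontinuousOn.exists_isMinOn (couplings_nonempty hν)
    (isCompact_couplings (I := I) hν) (lowerSemicontinuousOn_energy (c := c) (μ := μ) hc hρ hε hμ)
  exact ⟨γ, hγ, le_antisymm (iInf₂_le γ hγ) (le_iInf₂ fun η hη => hmin hη)⟩

/-- Strictness comes from the entropy of a block where γ and γ' differ. The marginal term is only
convex, being `negEnt` of the marginal plus an affine function. -/
theorem realEnergy_midpoint_lt (hρ : 0 < ρ) (hε : 0 < ε)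
    (hγ : ∀ i j, (γ i j).PosSemidef) (hγ' : ∀ i j, (γ' i j).PosSemidef) (hne : γ ≠ γ') :
    realEnergy c ρ ε μ ((1 / 2 : ℝ) • γ + (1 / 2 : ℝ) • γ') <
      1 / 2 * realEnergy c ρ ε μ γ + 1 / 2 * realEnergy c ρ ε μ γ' := by
  have half : (0 : ℝ) ≤ 1 / 2 := by norm_num
  have h1 : ∑ i, relEnt (∑ j, ((1 / 2 : ℝ) • γ + (1 / 2 : ℝ) • γ') i j) (μ i) ≤
      1 / 2 * ∑ i, relEnt (∑ j, γ i j) (μ i) + 1 / 2 * ∑ i, relEnt (∑ j, γ' i j) (μ i) := by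
    rw [Finset.mul_sum, Finset.mul_sum, ← Finset.sum_add_distrib]
    refine Finset.sum_le_sum fun i _ => ?_
    have e : ∑ j, ((1 / 2 : ℝ) • γ + (1 / 2 : ℝ) • γ') i j =
        (1 / 2 : ℝ) • ∑ j, γ i j + (1 / 2 : ℝ) • ∑ j, γ' i j := by
      simp only [Pi.add_apply, Pi.smul_apply, Finset.sum_add_distrib, Finset.smul_sum]
    have hconv := convexLSC_negEnt.convex.2 (Matrix.posSemidef_sum Finset.univ fun j _ => hγ i j)
      (Matrix.posSemidef_sum Finset.univ fun j _ => hγ' i j) half half (by norm_num)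
    rw [e, relEnt_eq, relEnt_eq, relEnt_eq, Matrix.add_mul, Matrix.smul_mul, Matrix.smul_mul,
      Matrix.trace_add, Matrix.trace_smul, Matrix.trace_smul]
    simp only [smul_eq_mul] at hconv ⊢
    linarith
  have hle : ∀ i j, negEnt (((1 / 2 : ℝ) • γ + (1 / 2 : ℝ) • γ') i j) ≤
      1 / 2 * negEnt (γ i j) + 1 / 2 * negEnt (γ' i j) := fun i j =>
    convexLSC_negEnt.convex.2 (hγ i j) (hγ' i j) half half (by norm_num)
  have h2 : ∑ i, ∑ j, negEnt (((1 / 2 : ℝ) • γ + (1 / 2 : ℝ) • γ') i j) <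
      1 / 2 * ∑ i, ∑ j, negEnt (γ i j) + 1 / 2 * ∑ i, ∑ j, negEnt (γ' i j) := by
    simp only [Finset.mul_sum, ← Finset.sum_add_distrib]
    obtain ⟨i, hi⟩ := Function.ne_iff.1 hne
    obtain ⟨j, hj⟩ := Function.ne_iff.1 hi
    exact Finset.sum_lt_sum (fun i _ => Finset.sum_le_sum fun j _ => hle i j)
      ⟨i, Finset.mem_univ i, Finset.sum_lt_sum (fun j _ => hle i j)
        ⟨j, Finset.mem_univ j, negEnt_midpoint_lt (hγ i j) (hγ' i j) hj⟩⟩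
  have h3 : ∑ i, ∑ j, (((1 / 2 : ℝ) • γ + (1 / 2 : ℝ) • γ') i j * c i j).trace =
      1 / 2 * ∑ i, ∑ j, (γ i j * c i j).trace + 1 / 2 * ∑ i, ∑ j, (γ' i j * c i j).trace := by
    simp only [Pi.add_apply, Pi.smul_apply, Matrix.add_mul, Matrix.smul_mul, Matrix.trace_add,
      Matrix.trace_smul, smul_eq_mul, Finset.sum_add_distrib, Finset.mul_sum]
  have h4 := mul_le_mul_of_nonneg_left h1 hρ.le
  have h5 := mul_lt_mul_of_pos_left h2 hε
  simp only [realEnergy]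
  rw [h3]
  linarith

/-- Optimal couplings of distinct ν and η are distinct, since their second marginals differ, and
their midpoint is admissible for the midpoint of ν and η. -/
theorem W_midpoint_lt [Nonempty I] (hc : ∀ i j, (c i j).IsSymm) (hρ : 0 < ρ) (hε : 0 < ε)
    (hμ : ∀ i, (μ i).PosSemidef) {η : J → Mat d} (hν : ν ∈ psdFields d J)
    (hη : η ∈ psdFields d J) (hne : ν ≠ η) (h1 : W c ρ ε μ ν ≠ ⊤) (h2 : W c ρ ε μ η ≠ ⊤) :
    ∃ a b e : ℝ, W c ρ ε μ ν = a ∧ W c ρ ε μ η = b ∧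
      W c ρ ε μ ((1 / 2 : ℝ) • ν + (1 / 2 : ℝ) • η) ≤ e ∧ e < 1 / 2 * a + 1 / 2 * b := by
  have half : (0 : ℝ) ≤ 1 / 2 := by norm_num
  obtain ⟨γ, hγ, e1⟩ := exists_W_eq_energy hc hρ hε hμ hν
  obtain ⟨γ', hγ', e2⟩ := exists_W_eq_energy hc hρ hε hμ hη
  have k1 := kerLE_of_energy_ne_top hc hρ hμ hγ.1 (e1 ▸ h1)
  have k2 := kerLE_of_energy_ne_top hc hρ hμ hγ'.1 (e2 ▸ h2)
  have hmid : ∀ i j, (((1 / 2 : ℝ) • γ + (1 / 2 : ℝ) • γ') i j).PosSemidef := fun i j =>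
    ((hγ.1 i j).smul half).add ((hγ'.1 i j).smul half)
  have kmid : ∀ i, KerLE (μ i) (∑ j, ((1 / 2 : ℝ) • γ + (1 / 2 : ℝ) • γ') i j) := by
    intro i x hx
    have e : ∑ j, ((1 / 2 : ℝ) • γ + (1 / 2 : ℝ) • γ') i j =
        (1 / 2 : ℝ) • ∑ j, γ i j + (1 / 2 : ℝ) • ∑ j, γ' i j := by
      simp only [Pi.add_apply, Pi.smul_apply, Finset.sum_add_distrib, Finset.smul_sum]
    rw [e, Matrix.add_mulVec, Matrix.smul_mulVec, Matrix.smul_mulVec, k1 i x hx, k2 i x hx,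
      smul_zero, add_zero]
  refine ⟨_, _, realEnergy c ρ ε μ ((1 / 2 : ℝ) • γ + (1 / 2 : ℝ) • γ'),
    e1.trans (energy_eq_realEnergy hc hγ.1 k1), e2.trans (energy_eq_realEnergy hc hγ'.1 k2), ?_,
    realEnergy_midpoint_lt hρ hε hγ.1 hγ'.1 ?_⟩
  · rw [← energy_eq_realEnergy hc hmid kmid]
    refine iInf₂_le _ ⟨hmid, fun j => ?_⟩
    simp only [Pi.add_apply, Pi.smul_apply, Finset.sum_add_distrib, ← Finset.smul_sum, hγ.2 j,
      hγ'.2 j]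
  · rintro rfl
    exact hne (funext fun j => (hγ.2 j).symm.trans (hγ'.2 j))

end

variable {μ : Λ → I → Mat d}

theorem W_ne_top_of_isBarycenter (hc : ∀ i j, (c i j).IsSymm) (hρ : 0 < ρ) (hε : 0 < ε)
    (hw : ∀ l, 0 < w l) (hμ : ∀ l i, (μ l i).PosSemidef) (hν : IsBarycenter c ρ ε w μ ν) (l : Λ) :
    W c ρ ε (μ l) ν ≠ ⊤ := by
  -- Comparison with ν = 0, where the functional is at most the constant C.
  have hfin : baryObjective c ρ ε w μ ν ≠ ⊤ := by
    refine ne_of_lt ((hν.2 zero_mem_psdFields).trans_lt ?_)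
    rw [baryObjective_eq hc hρ hε hw hμ zero_mem_psdFields]
    exact EReal.add_lt_top (EReal.coe_ne_top _)
      ((iSup_lagr_zero_le hc hρ hε hw).trans_lt EReal.zero_lt_top).ne
  have hbot : ∀ l, (w l : EReal) * W c ρ ε (μ l) ν ≠ ⊥ := fun l h => by
    have h1 := dualVal_le_W (p := 0) (ν := ν) hc hρ hε (hμ l)
      ⟨fun _ => Matrix.isSymm_zero, fun _ => Matrix.isSymm_zero⟩
    have h2 := mul_le_mul_of_nonneg_left h1 (EReal.coe_nonneg.2 (hw l).le)
    rw [h, ← EReal.coe_mul] at h2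
    exact absurd h2 (not_le.2 (EReal.bot_lt_coe _))
  intro htop
  refine ne_top_of_sum_le Finset.univ hbot hfin l (Finset.mem_univ l) ?_
  rw [htop, EReal.coe_mul_top_of_pos (hw l)]

theorem isBarycenter_unique [Nonempty I] (hc : ∀ i j, (c i j).IsSymm) (hρ : 0 < ρ) (hε : 0 < ε)
    (hw : ∀ l, 0 < w l) (hw1 : ∑ l, w l = 1) (hμ : ∀ l i, (μ l i).PosSemidef) {η : J → Mat d}
    (hν : IsBarycenter c ρ ε w μ ν) (hη : IsBarycenter c ρ ε w μ η) : ν = η := by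
  by_contra hne
  choose a b e ha hb he hlt using fun l => W_midpoint_lt hc hρ hε (hμ l) hν.1 hη.1 hne
    (W_ne_top_of_isBarycenter hc hρ hε hw hμ hν l) (W_ne_top_of_isBarycenter hc hρ hε hw hμ hη l)
  have half : (0 : ℝ) ≤ 1 / 2 := by norm_num
  have hΛ : (Finset.univ : Finset Λ).Nonempty := by
    by_contra h
    rw [Finset.not_nonempty_iff_eq_empty] at h
    rw [h, Finset.sum_empty] at hw1
    exact zero_ne_one hw1
  have e1 : baryObjective c ρ ε w μ ν = ((∑ l, w l * a l : ℝ) : EReal) := by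
    simp only [baryObjective, ha, coe_finset_sum, EReal.coe_mul]
  have e2 : baryObjective c ρ ε w μ η = ((∑ l, w l * b l : ℝ) : EReal) := by
    simp only [baryObjective, hb, coe_finset_sum, EReal.coe_mul]
  have e3 : baryObjective c ρ ε w μ ((1 / 2 : ℝ) • ν + (1 / 2 : ℝ) • η) ≤
      ((∑ l, w l * e l : ℝ) : EReal) := by
    simp only [baryObjective, coe_finset_sum, EReal.coe_mul]
    exact Finset.sum_le_sum fun l _ =>
      mul_le_mul_of_nonneg_left (he l) (EReal.coe_nonneg.2 (hw l).le)
  have hm : (1 / 2 : ℝ) • ν + (1 / 2 : ℝ) • η ∈ psdFields d J :=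
    convex_psdFields hν.1 hη.1 half half (by norm_num)
  have h1 := (hν.2 hm).trans e3
  have h2 := (hη.2 hm).trans e3
  rw [e1, EReal.coe_le_coe_iff] at h1
  rw [e2, EReal.coe_le_coe_iff] at h2
  have h3 : ∑ l, w l * e l < ∑ l, w l * (1 / 2 * a l + 1 / 2 * b l) :=
    Finset.sum_lt_sum_of_nonempty hΛ fun l _ => mul_lt_mul_of_pos_left (hlt l) (hw l)
  have h4 : ∑ l, w l * (1 / 2 * a l + 1 / 2 * b l) =
      1 / 2 * ∑ l, w l * a l + 1 / 2 * ∑ l, w l * b l := by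
    rw [Finset.mul_sum, Finset.mul_sum, ← Finset.sum_add_distrib]
    exact Finset.sum_congr rfl fun l _ => by ring
  linarith

/-! ### Max-min and saddle point characterizations -/

theorem isBarycenter_iff_iSup_eq (hc : ∀ i j, (c i j).IsSymm) (hρ : 0 < ρ) (hε : 0 < ε)
    (hw : ∀ l, 0 < w l) (hw1 : ∑ l, w l = 1) (hμ : ∀ l i, (μ l i).PosSemidef)
    (hν : ν ∈ psdFields d J) : IsBarycenter c ρ ε w μ ν ↔
      (⨆ p ∈ dualVars d I J Λ, (lagr c ρ ε w μ ν p : EReal)) =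
        ⨆ p ∈ dualVars d I J Λ, innerMin c ρ ε w μ p := by
  rw [isBarycenter_iff, iInf_baryObjective_eq hc hρ hε hw hw1 hμ,
    baryObjective_eq hc hρ hε hw hμ hν, and_iff_right hν]
  refine ⟨fun h => ?_, fun h => by rw [h]⟩
  -- Addition can be cancelled in `EReal` here because the constant is finite.
  have hle : ∀ {C : ℝ} {x y : EReal}, (C : EReal) + x ≤ (C : EReal) + y → x ≤ y := fun {C x y} h =>
    not_lt.1 fun h' => not_lt.2 h (EReal.add_lt_add_left_coe h' C)
  exact le_antisymm (hle h.le) (hle h.ge)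

theorem isBarycenter_iff_isSaddlePointOn (hc : ∀ i j, (c i j).IsSymm) (hρ : 0 < ρ) (hε : 0 < ε)
    (hw : ∀ l, 0 < w l) (hw1 : ∑ l, w l = 1) (hμ : ∀ l i, (μ l i).PosSemidef)
    {p : (Λ → I → Mat d) × (Λ → J → Mat d)} (hp : p ∈ dualVars d I J Λ)
    (hmax : IsMaxOn (innerMin c ρ ε w μ) (dualVars d I J Λ) p) (hν : ν ∈ psdFields d J) :
    IsBarycenter c ρ ε w μ ν ↔
      IsSaddlePointOn (psdFields d J) (dualVars d I J Λ) (lagr c ρ ε w μ) ν p := by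
  have e : ⨆ p ∈ dualVars d I J Λ, innerMin c ρ ε w μ p = innerMin c ρ ε w μ p :=
    le_antisymm (iSup₂_le fun q hq => hmax hq)
      (le_iSup₂ (f := fun p _ => innerMin c ρ ε w μ p) p hp)
  rw [isBarycenter_iff_iSup_eq hc hρ hε hw hw1 hμ hν, e]
  constructor
  · intro h η hη q hq
    have h1 := le_iSup₂ (f := fun p (_ : p ∈ dualVars d I J Λ) =>
      (lagr c ρ ε w μ ν p : EReal)) q hq
    rw [h] at h1
    exact EReal.coe_le_coe_iff.1 (h1.trans (iInf₂_le η hη))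
  · intro h
    refine le_antisymm (iSup₂_le fun q hq => le_iInf₂ fun η hη =>
      EReal.coe_le_coe_iff.2 (h η hη q hq)) ?_
    exact (iInf₂_le ν hν).trans
      (le_iSup₂ (f := fun p _ => (lagr c ρ ε w μ ν p : EReal)) p hp)

end

end QuantumOT

end

/-! ### The main theorem -/

theorem proposition3 {d : ℕ} {I J Λ : Type*} [Fintype I] [Fintype J] [Fintype Λ]
    [Nonempty I] [Nonempty J]
    (c : I → J → QuantumOT.Mat d) (hc : ∀ i j, (c i j).IsSymm)
    (ρ ε : ℝ) (hρ : 0 < ρ) (hε : 0 < ε)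
    (w : Λ → ℝ) (hw : ∀ l, 0 < w l) (hw1 : ∑ l, w l = 1)
    (μ : Λ → I → QuantumOT.Mat d) (hμ : ∀ l i, (μ l i).PosSemidef) :
    -- the barycenter problem has exactly one solution
    (∃! ν, QuantumOT.IsBarycenter c ρ ε w μ ν) ∧
    -- up to the additive constant, the barycenter functional is the supremum over the dual
    -- variables
    (∀ ν ∈ QuantumOT.psdFields d J,
      QuantumOT.baryObjective c ρ ε w μ ν =
        ((ρ * ∑ l, w l * ∑ i, (μ l i).trace : ℝ) : EReal) +
          ⨆ p ∈ QuantumOT.dualVars d I J Λ, (QuantumOT.lagr c ρ ε w μ ν p : EReal)) ∧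
    -- up to the same constant, the optimal value is the value of the max-min problem
    ((⨅ ν ∈ QuantumOT.psdFields d J, QuantumOT.baryObjective c ρ ε w μ ν) =
        ((ρ * ∑ l, w l * ∑ i, (μ l i).trace : ℝ) : EReal) +
          ⨆ p ∈ QuantumOT.dualVars d I J Λ, QuantumOT.innerMin c ρ ε w μ p) ∧
    -- the barycenter is the `ν` at which the value of the max-min problem is reached
    (∀ ν ∈ QuantumOT.psdFields d J,
      QuantumOT.IsBarycenter c ρ ε w μ ν ↔
        (⨆ p ∈ QuantumOT.dualVars d I J Λ, (QuantumOT.lagr c ρ ε w μ ν p : EReal)) =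
          ⨆ p ∈ QuantumOT.dualVars d I J Λ, QuantumOT.innerMin c ρ ε w μ p) ∧
    -- for positive definite inputs the outer maximum is attained, and at each maximizer the
    -- barycenter is the `ν` that forms a saddle point with it
    ((∀ l i, (μ l i).PosDef) →
      (∃ p ∈ QuantumOT.dualVars d I J Λ,
        IsMaxOn (QuantumOT.innerMin c ρ ε w μ) (QuantumOT.dualVars d I J Λ) p) ∧
      ∀ p ∈ QuantumOT.dualVars d I J Λ,
        IsMaxOn (QuantumOT.innerMin c ρ ε w μ) (QuantumOT.dualVars d I J Λ) p →
        ∀ ν ∈ QuantumOT.psdFields d J,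
          (QuantumOT.IsBarycenter c ρ ε w μ ν ↔
            IsSaddlePointOn (QuantumOT.psdFields d J) (QuantumOT.dualVars d I J Λ)
              (QuantumOT.lagr c ρ ε w μ) ν p)) := by
  refine ⟨?_, fun ν hν => QuantumOT.baryObjective_eq hc hρ hε hw hμ hν,
    QuantumOT.iInf_baryObjective_eq hc hρ hε hw hw1 hμ,
    fun ν hν => QuantumOT.isBarycenter_iff_iSup_eq hc hρ hε hw hw1 hμ hν,
    fun hpd => ⟨QuantumOT.exists_isMaxOn_innerMin hc hρ hε hw hpd, fun p hp hmax ν hν =>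
      QuantumOT.isBarycenter_iff_isSaddlePointOn hc hρ hε hw hw1 hμ hp hmax hν⟩⟩
  obtain ⟨ν, hν⟩ := QuantumOT.exists_isBarycenter hc hρ hε hw hw1 hμ
  exact ⟨ν, hν, fun η hη => QuantumOT.isBarycenter_unique hc hρ hε hw hw1 hμ hη hν⟩
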